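/- Let $(\Omega,\mathscr F,\mathbb P)$ be a probability space, let $\theta=(\theta(1),\dots,\theta(r))^T\in\mathbb R^r$ be an unknown parameter vector, and consider the stochastic system $$y_{k+1}=\theta^T\varphi_k+w_{k+1},\qquad k\ge 0,$$ with scalar outputs $y_k$, regressors $\varphi_k\in\mathbb R^r$ and noise $w_k$. Let $u_k$ be the system inputs and $w'_k$ exogenous signals, and put $$\mathcal F_k=\sigma\{y_k,\dots,y_0,\;u_{k-1},\dots,u_0,\;w_k,\dots,w_0,\;w'_k,\dots,w'_0\},\qquad k\ge1 .$$ (No control law is prescribed, so feedback is allowed.) Denote by $\lambda_{\max}(N)$ and $\lambda_{\min}(N)$ the largest and smallest eigenvalues of $\sum_{k=1}^N\varphi_k\varphi_k^T$. From the data $\{\varphi_k,y_{k+1}\}_{k=1}^N$ form the least squares estimate $$\theta_{N+1}=\Big(\sum_{k=1}^N\varphi_k\varphi_k^T\Big)^{-1}\sum_{k=1}^N\varphi_ky_{k+1},$$ the modified estimate $$\widehat\theta_{N+1}(j)=\theta_{N+1}(j)+\operatorname{sgn}\big(\theta_{N+1}(j)\big)\sqrt{\frac{\log\lambda_{\max}(N)}{\lambda_{\min}(N)}},\qquad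 j=1,\dots,r,$$ where $\operatorname{sgn}(x)=1$ for $x\ge0$ and $\operatorname{sgn}(x)=-1$ for $x<0$, and, with coefficients $\lambda_N>0$, the estimate $$\beta_{N+1}\in\operatorname*{argmin}_{\beta\in\mathbb R^r}\;\Big\{\sum_{k=1}^N\big(y_{k+1}-\beta^T\varphi_k\big)^2+\lambda_N\sum_{l=1}^r\frac{|\beta(l)|}{|\widehat\theta_{N+1}(l)|}\Big\}.$$ Assume: A1) the $w_{k+1}$, $k\ge1$, are integrable with $\mathbb E[w_{k+1}\mid\mathcal F_k]=0$, and for some $\gamma>2$, $\sup_{k\ge1}\mathbb E\big[|w_{k+1}|^\gamma\mid\mathcal F_k\big]<\infty$ a.s.; A2) $\varphi_k$ is $\mathcal F_k$-measurable for each $k\ge1$; A3) a.s., $\lambda_{\min}(N)>0$ and $\lambda_{\max}(N)>1$ for all sufficiently large $N$ (so that the quantities below are eventually well defined and positive), and $$\frac{\lambda_{\max}(N)}{\lambda_{\min}(N)}\sqrt{\frac{\log\lambda_{\max}(N)}{\lambda_{\min}(N)}}\longrightarrow0\quad(N\to\infty)\quad\text{a.s.};$$ A4) $\{\lambda_N\}$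 is a positive sequence, possibly depending on the data, such that a.s., as $N\to\infty$, $$\frac{\lambda_N}{\lambda_{\min}(N)}\to0,\qquad \frac{1}{\lambda_N}\,\lambda_{\max}(N)\sqrt{\frac{\log\lambda_{\max}(N)}{\lambda_{\min}(N)}}\to0 .$$ Then there is $\Omega_0$ with $\mathbb P(\Omega_0)=1$ such that for every $\omega\in\Omega_0$ there is an integer $N_0(\omega)$ with $$\beta_{N+1}(j)=0\quad\text{for all }N\ge N_0(\omega)\text{ and all }j\text{ with }\theta(j)=0,$$ and $$\beta_{N+1}(i)\longrightarrow\theta(i)\quad(N\to\infty)\qquad\text{for all }i\text{ with }\theta(i)\ne0 .$$ -/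

import Mathlib

open MeasureTheory Filter Topology

noncomputable section

namespace SparseId

/-- The information available at time `k`: the sigma-algebra generated by
`y 0, …, y k`, `u 0, …, u (k-1)`, `w 0, …, w k`, `w' 0, …, w' k`. -/
abbrev info {Ω U V : Type*} [MeasurableSpace U] [MeasurableSpace V]
    (y : ℕ → Ω → ℝ) (u : ℕ → Ω → U) (w : ℕ → Ω → ℝ) (w' : ℕ → Ω → V) (k : ℕ) :
    MeasurableSpace Ω :=
  (⨆ i ∈ Set.Iic k, MeasurableSpace.comap (y i) inferInstance) ⊔
  (⨆ i ∈ Set.Iio k, MeasurableSpace.comap (u i) inferInstance) ⊔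
  (⨆ i ∈ Set.Iic k, MeasurableSpace.comap (w i) inferInstance) ⊔
  (⨆ i ∈ Set.Iic k, MeasurableSpace.comap (w' i) inferInstance)

/-- The sign function with the convention `sgn 0 = 1`. -/
def sgn (x : ℝ) : ℝ := if 0 ≤ x then 1 else -1

/-- Largest eigenvalue of a symmetric matrix. -/
def eigMax {r : ℕ} (M : Matrix (Fin r) (Fin r) ℝ) : ℝ := sSup (spectrum ℝ M)

/-- Smallest eigenvalue of a symmetric matrix. -/
def eigMin {r : ℕ} (M : Matrix (Fin r) (Fin r) ℝ) : ℝ := sInf (spectrum ℝ M)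

section Data

/- One sample path of the regressors `x k` and of the outputs `z k`. -/
variable {r : ℕ} (x : ℕ → Fin r → ℝ) (z : ℕ → ℝ)

/-- The matrix `∑_{k=1}^N x_k x_kᵀ`. -/
def gram (N : ℕ) : Matrix (Fin r) (Fin r) ℝ :=
  ∑ k ∈ Finset.Icc 1 N, Matrix.vecMulVec (x k) (x k)

/-- `λ_max(N)`. -/
def lamMax (N : ℕ) : ℝ := eigMax (gram x N)

/-- `λ_min(N)`. -/
def lamMin (N : ℕ) : ℝ := eigMin (gram x N)

/-- `√(log λ_max(N) / λ_min(N))`. -/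
def rate (N : ℕ) : ℝ := Real.sqrt (Real.log (lamMax x N) / lamMin x N)

/-- The least squares estimate `θ_{N+1}` based on `(x_k, z_{k+1})`, `1 ≤ k ≤ N`. -/
def lsEstimate (N : ℕ) : Fin r → ℝ :=
  Matrix.mulVec (gram x N)⁻¹ (∑ k ∈ Finset.Icc 1 N, z (k + 1) • x k)

/-- The modified least squares estimate `θ̂_{N+1}`. -/
def modEstimate (N : ℕ) (j : Fin r) : ℝ :=
  lsEstimate x z N j + sgn (lsEstimate x z N j) * rate x N

/-- The criterion `J_{N+1}(b)` with regularization coefficient `c` (that is, `c = λ_N`). -/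
def criterion (c : ℝ) (N : ℕ) (b : Fin r → ℝ) : ℝ :=
  ∑ k ∈ Finset.Icc 1 N, (z (k + 1) - b ⬝ᵥ x k) ^ 2 +
    c * ∑ l, 1 / |modEstimate x z N l| * |b l|

end Data

end SparseId

end

/-! The engine is the Lai–Wei rate for least squares: almost surely the error of θ_{N+1} is
O(`rate`), even under feedback. Everything after it is deterministic, one sample path at a time
(`eventually_eq_zero_and_tendsto`).

Consistency: where θ(l) ≠ 0 the penalty weight 1/|θ̂(l)| stays bounded, so comparing the criterion
at β and at θ gives |β − θ|² = O(`rate`² + (λ_N/λ_min)²), which tends to 0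
(`lamMin_mul_dotProduct_sub_le`). Sparsity: where θ(j) = 0, |θ̂(j)| is positive and O(`rate`), so
the weight is huge. If β(j) ≠ 0, replacing it by 0 raises the sum of squares by at most 3 λ_max
|β(j)| once the errors are small, so minimality forces λ_N ≤ 3 λ_max |θ̂(j)| = O(λ_max · `rate`),
against A4 (`mul_inv_abs_modEstimate_le`).

For the Lai–Wei rate, let S_n = ∑ v_k x_k and let G_n be the Gram matrix. Rank-one updates give an
exact identity for S_nᵀ(1 + G_n)⁻¹S_n (`quadForm_score_eq`), driven by a martingale transform and by
∑ a_k v_k², where the leverages a_k satisfy ∑ a_k ≤ log det(1 + G_n). Both random sums are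
controlled by a strong law for martingale transforms (`ae_exists_abs_weighted_sum_le`). The
condition γ > 2 gives the centred squares of the noise a conditional moment of some order p > 1. A
localization then replaces uniform moment bounds by almost surely finite ones. -/

noncomputable section
namespace SparseId
open scoped ENNReal NNReal

/-! ### Elementary inequalities for powers 1 < p ≤ 2 -/

theorem abs_one_add_rpow_le {p : ℝ} (hp1 : 1 < p) (hp2 : p ≤ 2) (t : ℝ) :
    |1 + t| ^ p ≤ 1 + p * t + 6 * |t| ^ p := by
  -- For |t| ≤ 1, Bernoulli's inequality for the concave power p − 1, multiplied by 1 + t, leaves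
  -- the remainder (p − 1)t² ≤ |t|^p. For |t| ≥ 1 the left side is at most 4|t|^p and −pt ≤ 2|t|^p;
  -- hence 6 = 4 + 2.
  rcases le_total |t| 1 with ht | ht
  · have ht' := abs_le.1 ht
    have h1 : 0 ≤ 1 + t := by linarith
    have h2 : |1 + t| ^ p = (1 + t) * (1 + t) ^ (p - 1) := by
      rw [abs_of_nonneg h1]
      conv_lhs => rw [show p = 1 + (p - 1) by ring]
      rw [Real.rpow_add_of_nonneg h1 zero_le_one (by linarith), Real.rpow_one]
    have h3 := rpow_one_add_le_one_add_mul_self ht'.1 (p := p - 1) (by linarith) (by linarith)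
    have h4 : t ^ 2 ≤ |t| ^ p := by
      rw [← sq_abs, ← Real.rpow_natCast]
      rcases eq_or_lt_of_le (abs_nonneg t) with h | h
      · rw [← h, Real.zero_rpow (by simp), Real.zero_rpow (by linarith)]
      · exact Real.rpow_le_rpow_of_exponent_ge h ht (by simpa using hp2)
    rw [h2]
    nlinarith [mul_le_mul_of_nonneg_left h3 h1, sq_nonneg t]
  · have h1 : |1 + t| ^ p ≤ (2 * |t|) ^ p := by
      refine Real.rpow_le_rpow (abs_nonneg _) ?_ (by linarith)
      calc |1 + t| ≤ |1| + |t| := abs_add_le _ _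
        _ ≤ 2 * |t| := by rw [abs_one]; linarith
    rw [Real.mul_rpow (by norm_num) (abs_nonneg t)] at h1
    have h2 : (2 : ℝ) ^ p ≤ 4 := by
      calc (2 : ℝ) ^ p ≤ 2 ^ (2 : ℝ) := Real.rpow_le_rpow_of_exponent_le (by norm_num) hp2
        _ = 4 := by norm_num
    have h3 : |t| ≤ |t| ^ p := Real.self_le_rpow_of_one_le ht hp1.le
    have h4 : -(p * t) ≤ 2 * |t| := by
      have := neg_abs_le t
      nlinarith [abs_nonneg t]
    nlinarith [mul_le_mul_of_nonneg_right h2 (abs_nonneg t |>.trans h3)]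

/-- A one-step inequality behind the von Bahr–Esseen moment bound. -/
theorem abs_add_rpow_le {p : ℝ} (hp1 : 1 < p) (hp2 : p ≤ 2) (x y : ℝ) :
    |x + y| ^ p ≤ |x| ^ p + p * (x * |x| ^ (p - 2)) * y + 6 * |y| ^ p := by
  rcases eq_or_ne x 0 with rfl | hx
  · have : 0 ≤ |y| ^ p := by positivity
    rw [abs_zero, Real.zero_rpow (by linarith)]
    simp
    linarith
  have h := abs_one_add_rpow_le hp1 hp2 (y / x)
  have hx' : 0 < |x| := abs_pos.2 hx
  have h1 : |x + y| ^ p = |x| ^ p * |1 + y / x| ^ p := by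
    rw [← Real.mul_rpow (abs_nonneg _) (abs_nonneg _), ← abs_mul]
    congr 2; field_simp
  have h2 : |y| ^ p = |x| ^ p * |y / x| ^ p := by
    rw [← Real.mul_rpow (abs_nonneg _) (abs_nonneg _), ← abs_mul]
    congr 2; field_simp
  have h3 : |x| ^ p * (y / x) = (x * |x| ^ (p - 2)) * y := by
    have : |x| ^ p = |x| ^ (p - 2) * (x * x) := by
      rw [← abs_mul_abs_self x, ← sq, ← Real.rpow_natCast, ← Real.rpow_add hx']
      norm_num
    rw [this]; field_simp
  have h4 : 0 < |x| ^ p := by positivity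
  calc |x + y| ^ p ≤ |x| ^ p * (1 + p * (y / x) + 6 * |y / x| ^ p) := by
        rw [h1]; gcongr
    _ = |x| ^ p + p * (|x| ^ p * (y / x)) + 6 * (|x| ^ p * |y / x| ^ p) := by ring
    _ = _ := by rw [h3, ← h2]; ring

/-- Makes the cross term of `abs_add_rpow_le` integrable, so that its expectation can be shown to
vanish. -/
theorem abs_mul_rpow_mul_le {p : ℝ} (hp1 : 1 < p) (x y : ℝ) :
    |x * |x| ^ (p - 2) * y| ≤ |x| ^ p + |y| ^ p := by
  have hxp : |x * |x| ^ (p - 2) * y| = |x| ^ (p - 1) * |y| := by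
    rcases eq_or_ne x 0 with rfl | hx
    · simp [Real.zero_rpow (by linarith : p - 1 ≠ 0)]
    · rw [abs_mul, abs_mul, abs_of_nonneg (by positivity : 0 ≤ |x| ^ (p - 2)), mul_comm |x|,
        ← Real.rpow_add_one (abs_ne_zero.2 hx)]
      ring_nf
  rw [hxp]
  have key : ∀ z : ℝ, 0 ≤ z → z ^ (p - 1) * z = z ^ p := fun z hz => by
    conv_rhs => rw [show p = (p - 1) + 1 by ring]
    rw [Real.rpow_add_of_nonneg hz (by linarith) zero_le_one, Real.rpow_one]
  have hx : 0 ≤ |x| ^ p := by positivity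
  have hy : 0 ≤ |y| ^ p := by positivity
  rcases le_total |x| |y| with h | h
  · calc |x| ^ (p - 1) * |y| ≤ |y| ^ (p - 1) * |y| := by
          gcongr
      _ ≤ _ := by rw [key _ (abs_nonneg _)]; linarith
  · calc |x| ^ (p - 1) * |y| ≤ |x| ^ (p - 1) * |x| := by gcongr
      _ ≤ _ := by rw [key _ (abs_nonneg _)]; linarith

/-! ### Conditional moment bounds -/

variable {Ω : Type*} {m m0 : MeasurableSpace Ω}

/-- The conditional moment of order `p` of `f` given `m` is at most `K`. -/
def CondMomentLE {m0 : MeasurableSpace Ω} (P : Measure Ω) (m : MeasurableSpace Ω) (p : ℝ)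
    (K : ℝ≥0) (f : Ω → ℝ) : Prop :=
  ∀ s, MeasurableSet[m] s → ∫⁻ ω in s, ENNReal.ofReal (|f ω| ^ p) ∂P ≤ K * P s

/-- On `m` the measure with density |f|^p is dominated by K·P, so integrating any `m`-measurable
weight preserves the inequality. -/
theorem CondMomentLE.lintegral_mul_le {P : Measure Ω} (hm : m ≤ m0)
    {p : ℝ} {K : ℝ≥0} {f : Ω → ℝ} (hf : Measurable f) (h : CondMomentLE P m p K f)
    {g : Ω → ℝ≥0∞} (hg : Measurable[m] g) :
    ∫⁻ ω, g ω * ENNReal.ofReal (|f ω| ^ p) ∂P ≤ K * ∫⁻ ω, g ω ∂P := by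
  have hfm : Measurable fun ω => ENNReal.ofReal (|f ω| ^ p) := by
    have : Measurable fun ω => |f ω| := hf.abs
    fun_prop
  have hle : (P.withDensity fun ω => ENNReal.ofReal (|f ω| ^ p)).trim hm ≤
      ((K : ℝ≥0∞) • P).trim hm := by
    refine Measure.le_iff.2 fun s hs => ?_
    rw [trim_measurableSet_eq hm hs, trim_measurableSet_eq hm hs, withDensity_apply _ (hm s hs)]
    simpa using h s hs
  have h1 := lintegral_mono' hle (le_refl g)
  rw [lintegral_trim hm hg, lintegral_trim hm hg,
    lintegral_withDensity_eq_lintegral_mul _ hfm (hg.mono hm le_rfl), lintegral_smul_measure] at h1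
  simpa [mul_comm] using h1

theorem CondMomentLE.memLp {P : Measure Ω} [IsFiniteMeasure P]
    {p : ℝ} (hp : 0 < p) {K : ℝ≥0} {f : Ω → ℝ} (hf : Measurable f) (h : CondMomentLE P m p K f) :
    MemLp f (ENNReal.ofReal p) P := by
  refine ⟨hf.aestronglyMeasurable, ?_⟩
  rw [eLpNorm_lt_top_iff_lintegral_rpow_enorm_lt_top (by simpa using hp) (by simp)]
  have h1 := h Set.univ (@MeasurableSet.univ _ m)
  rw [ENNReal.toReal_ofReal hp.le]
  calc ∫⁻ a, ‖f a‖ₑ ^ p ∂P = ∫⁻ ω in Set.univ, ENNReal.ofReal (|f ω| ^ p) ∂P := by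
        simp only [Measure.restrict_univ]
        refine lintegral_congr fun ω => ?_
        rw [← ENNReal.ofReal_rpow_of_nonneg (abs_nonneg _) hp.le, Real.enorm_eq_ofReal_abs]
    _ ≤ K * P Set.univ := h1
    _ < ∞ := ENNReal.mul_lt_top (by simp) (measure_lt_top _ _)

theorem CondMomentLE.mono {P : Measure Ω}
    {p q : ℝ} {K a b : ℝ≥0} {f g : Ω → ℝ} (h : CondMomentLE P m p K f)
    (hg : ∀ᵐ ω ∂P, |g ω| ^ q ≤ a + b * |f ω| ^ p) : CondMomentLE P m q (a + b * K) g := by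
  intro s hs
  calc ∫⁻ ω in s, ENNReal.ofReal (|g ω| ^ q) ∂P
      ≤ ∫⁻ ω in s, (a + b * ENNReal.ofReal (|f ω| ^ p)) ∂P := by
        refine lintegral_mono_ae (ae_restrict_of_ae ?_)
        filter_upwards [hg] with ω hω
        refine (ENNReal.ofReal_le_ofReal hω).trans ?_
        rw [ENNReal.ofReal_add (by positivity) (by positivity),
          ENNReal.ofReal_mul (by positivity)]
        simp
    _ = a * P s + b * ∫⁻ ω in s, ENNReal.ofReal (|f ω| ^ p) ∂P := by
        rw [lintegral_add_left (by fun_prop), lintegral_const_mul' _ _ (by simp)]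
        simp
    _ ≤ a * P s + b * (K * P s) := by gcongr; exact h s hs
    _ = _ := by push_cast; ring


/-- Integral form of the bound on the conditional moment. -/
theorem CondMomentLE.integral_mul_le {P : Measure Ω} [IsFiniteMeasure P] (hm : m ≤ m0)
    {p : ℝ} {K : ℝ≥0} {f : Ω → ℝ} (hf : Measurable f) (h : CondMomentLE P m p K f)
    {g : Ω → ℝ} (hg : Measurable[m] g) (hg0 : ∀ ω, 0 ≤ g ω) (hgi : Integrable g P) :
    ∫ ω, g ω * |f ω| ^ p ∂P ≤ K * ∫ ω, g ω ∂P := by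
  have hfm : Measurable fun ω => |f ω| ^ p := by
    have : Measurable fun ω => |f ω| := hf.abs
    fun_prop
  have hgm : Measurable g := hg.mono hm le_rfl
  have h1 := h.lintegral_mul_le hm hf (g := fun ω => ENNReal.ofReal (g ω)) hg.ennreal_ofReal
  rw [integral_eq_lintegral_of_nonneg_ae (ae_of_all _ fun ω => mul_nonneg (hg0 ω) (by positivity))
      (by fun_prop),
    integral_eq_lintegral_of_nonneg_ae (ae_of_all _ hg0) (by fun_prop)]
  have h2 : ∫⁻ ω, ENNReal.ofReal (g ω) ∂P ≠ ∞ := hgi.lintegral_lt_top.ne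
  rw [← ENNReal.coe_toReal, ← ENNReal.toReal_mul]
  refine ENNReal.toReal_mono (ENNReal.mul_ne_top (by simp) h2) (le_trans (le_of_eq ?_) h1)
  exact lintegral_congr fun ω => ENNReal.ofReal_mul (hg0 ω)

theorem integral_mul_eq_zero_of_condExp {P : Measure Ω} [IsFiniteMeasure P] (hm : m ≤ m0)
    {f g : Ω → ℝ} (hf : P[f | m] =ᵐ[P] 0) (hfi : Integrable f P) (hg : Measurable[m] g)
    (hgf : Integrable (fun ω => g ω * f ω) P) : ∫ ω, g ω * f ω ∂P = 0 := by
  have h1 := condExp_mul_of_stronglyMeasurable_left (μ := P) hg.stronglyMeasurable hgf hfi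
  have h2 : ∫ ω, (P[fun ω => g ω * f ω | m]) ω ∂P = ∫ ω, g ω * f ω ∂P := integral_condExp hm
  have h3 : P[fun ω => g ω * f ω | m] =ᵐ[P] 0 := by
    filter_upwards [hf, h1] with ω hω hω'
    exact hω'.trans (by simp [hω])
  rw [← h2, integral_congr_ae h3]
  simp

/-! ### Convergence of martingale transforms -/

section Martingale

variable {P : Measure Ω} [IsProbabilityMeasure P] {ℱ : Filtration ℕ m0} {p : ℝ} {K : ℝ≥0}
  {ε : ℕ → Ω → ℝ}

theorem measurable_weighted_sum (hε : ∀ n, Measurable[ℱ (n + 1)] (ε n))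
    {e : ℕ → Ω → ℝ} (he : ∀ n, Measurable[ℱ n] (e n)) (n : ℕ) :
    Measurable[ℱ n] (fun ω => ∑ k ∈ Finset.range n, e k ω * ε k ω) := by
  refine Finset.measurable_fun_sum _ fun k hk => ?_
  have hk := Finset.mem_range.1 hk
  exact ((he k).mono (ℱ.mono hk.le) le_rfl).mul ((hε k).mono (ℱ.mono hk) le_rfl)

/-- Convergence of martingale transforms with `∑ |e k| ^ p` bounded. -/
theorem ae_tendsto_weighted_sum_of_bdd (hp1 : 1 < p) (hp2 : p ≤ 2)
    (hε : ∀ n, Measurable[ℱ (n + 1)] (ε n)) (hmart : ∀ n, P[ε n | ℱ n] =ᵐ[P] 0)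
    (hmom : ∀ n, CondMomentLE P (ℱ n) p K (ε n))
    {e : ℕ → Ω → ℝ} (he : ∀ n, Measurable[ℱ n] (e n)) {R : ℝ}
    (hsum : ∀ n ω, ∑ k ∈ Finset.range n, |e k ω| ^ p ≤ R) :
    ∀ᵐ ω ∂P, ∃ c, Tendsto (fun n => ∑ k ∈ Finset.range n, e k ω * ε k ω) atTop (𝓝 c) := by
  have hp0 : 0 < p := by linarith
  have hpe : (ENNReal.ofReal p) ≠ 0 := by simpa using hp0
  have hpr : (ENNReal.ofReal p).toReal = p := ENNReal.toReal_ofReal hp0.le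
  have hp1e : 1 ≤ ENNReal.ofReal p := by simpa using ENNReal.ofReal_le_ofReal hp1.le
  have hε' : ∀ n, Measurable (ε n) := fun n => (hε n).mono (ℱ.le _) le_rfl
  have he' : ∀ n, Measurable (e n) := fun n => (he n).mono (ℱ.le _) le_rfl
  have hεL : ∀ n, MemLp (ε n) (ENNReal.ofReal p) P := fun n => (hmom n).memLp hp0 (hε' n)
  have heb : ∀ n ω, |e n ω| ≤ R ^ p⁻¹ := fun n ω => by
    have h1 : |e n ω| ^ p ≤ R := le_trans
      (Finset.single_le_sum (f := fun k => |e k ω| ^ p) (fun k _ => by positivity)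
        (Finset.self_mem_range_succ n)) (hsum (n + 1) ω)
    have h2 := Real.rpow_le_rpow (by positivity) h1 (inv_nonneg.2 hp0.le)
    rwa [Real.rpow_rpow_inv (abs_nonneg _) hp0.ne'] at h2
  have heεL : ∀ n, MemLp (fun ω => e n ω * ε n ω) (ENNReal.ofReal p) P := fun n => by
    refine MemLp.of_le_mul (c := R ^ p⁻¹) (hεL n) (by fun_prop) (ae_of_all _ fun ω => ?_)
    rw [norm_mul]
    exact mul_le_mul_of_nonneg_right (heb n ω) (norm_nonneg _)
  set M : ℕ → Ω → ℝ := fun n ω => ∑ k ∈ Finset.range n, e k ω * ε k ω with hM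
  have hML : ∀ n, MemLp (M n) (ENNReal.ofReal p) P := fun n =>
    memLp_finsetSum _ fun k _ => heεL k
  have hMm : ∀ n, Measurable[ℱ n] (M n) := measurable_weighted_sum hε he
  have hMs : ∀ n ω, M (n + 1) ω = M n ω + e n ω * ε n ω := fun n ω => by
    simp [hM, Finset.sum_range_succ]
  have hint : ∀ {f : Ω → ℝ}, MemLp f (ENNReal.ofReal p) P → Integrable (fun ω => |f ω| ^ p) P :=
    fun {f} hf => by simpa [hpr] using hf.integrable_norm_rpow hpe (by simp)
  have habs : ∀ {f : Ω → ℝ} {m : MeasurableSpace Ω}, Measurable[m] f →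
      Measurable[m] fun ω => |f ω| ^ p := fun {f m} hf =>
    (by fun_prop : Measurable fun x : ℝ => |x| ^ p).comp hf
  have hmartM : Martingale M ℱ P := by
    refine martingale_nat (fun n => (hMm n).stronglyMeasurable)
      (fun n => (hML n).integrable hp1e) fun n => ?_
    have h1 : M (n + 1) = M n + e n * ε n := by ext ω; simp [hMs]
    rw [h1]
    have h2 := condExp_add ((hML n).integrable hp1e) ((heεL n).integrable hp1e) (ℱ n)
    have h3 := condExp_mul_of_stronglyMeasurable_left (μ := P) (he n).stronglyMeasurable
      ((heεL n).integrable hp1e) ((hεL n).integrable hp1e)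
    have h4 : P[M n | ℱ n] = M n := condExp_of_stronglyMeasurable (ℱ.le n)
      (hMm n).stronglyMeasurable ((hML n).integrable hp1e)
    filter_upwards [h2, h3, hmart n] with ω a2 a3 a4
    have a2' : (P[M n + e n * ε n | ℱ n]) ω = (P[M n | ℱ n]) ω + (P[e n * ε n | ℱ n]) ω := a2
    rw [a2', h4, a3]
    simp [a4]
  have hei : ∀ n, Integrable (fun ω => |e n ω| ^ p) P := fun n => by
    refine Integrable.of_bound ((habs (he' n)).aestronglyMeasurable) ((R ^ p⁻¹) ^ p)
      (ae_of_all _ fun ω => ?_)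
    rw [Real.norm_of_nonneg (by positivity)]
    exact Real.rpow_le_rpow (abs_nonneg _) (heb n ω) hp0.le
  -- The von Bahr–Esseen step: the term linear in `ε n` has a predictable coefficient and integrates
  -- to zero.
  have hstep : ∀ n, ∫ ω, |M (n + 1) ω| ^ p ∂P ≤
      ∫ ω, |M n ω| ^ p ∂P + 6 * (K * ∫ ω, |e n ω| ^ p ∂P) := fun n => by
    have hgm : Measurable[ℱ n] fun ω => p * (M n ω * |M n ω| ^ (p - 2)) * e n ω :=
      ((by fun_prop : Measurable fun x : ℝ => p * (x * |x| ^ (p - 2))).comp (hMm n)).mul (he n)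
    have hgi : Integrable (fun ω => p * (M n ω * |M n ω| ^ (p - 2)) * e n ω
        * ε n ω) P := by
      refine Integrable.mono' (((hint (hML n)).add (hint (heεL n))).const_mul p)
        ((hgm.mono (ℱ.le n) le_rfl).mul (hε' n)).aestronglyMeasurable (ae_of_all _ fun ω => ?_)
      have := abs_mul_rpow_mul_le hp1 (M n ω) (e n ω * ε n ω)
      rw [Real.norm_eq_abs]
      calc _ = p * |M n ω * |M n ω| ^ (p - 2) * (e n ω * ε n ω)| := by
            rw [← abs_of_pos hp0, ← abs_mul, abs_of_pos hp0]; ring_nf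
        _ ≤ _ := mul_le_mul_of_nonneg_left this hp0.le
    have hzero := integral_mul_eq_zero_of_condExp (ℱ.le n) (hmart n) ((hεL n).integrable hp1e)
      hgm hgi
    have hK := (hmom n).integral_mul_le (ℱ.le n) (hε' n) (g := fun ω => |e n ω| ^ p)
      (habs (he n)) (fun ω => by positivity) (hei n)
    have heq : ∀ ω, |e n ω * ε n ω| ^ p = |e n ω| ^ p * |ε n ω| ^ p := fun ω => by
      rw [abs_mul, Real.mul_rpow (abs_nonneg _) (abs_nonneg _)]
    have i3 := hint (heεL n)
    calc ∫ ω, |M (n + 1) ω| ^ p ∂P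
        ≤ ∫ ω, (|M n ω| ^ p + p * (M n ω * |M n ω| ^ (p - 2)) * e n ω * ε n ω
            + 6 * |e n ω * ε n ω| ^ p) ∂P := by
          refine integral_mono (hint (hML _)) (((hint (hML n)).add hgi).add (i3.const_mul 6))
            fun ω => ?_
          have := abs_add_rpow_le hp1 hp2 (M n ω) (e n ω * ε n ω)
          simp only [hMs]
          linarith
      _ = ∫ ω, |M n ω| ^ p ∂P + 6 * ∫ ω, |e n ω * ε n ω| ^ p ∂P := by
          have h1 := integral_add (hint (hML n)) hgi
          have h2 := integral_add ((hint (hML n)).add hgi) (i3.const_mul 6)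
          simp only [Pi.add_apply] at h2
          rw [h2, h1, hzero, add_zero, integral_const_mul]
      _ ≤ _ := by
          simp only [heq]
          linarith
  have hbd : ∀ n, ∫ ω, |M n ω| ^ p ∂P ≤ 6 * (K * R) := fun n => by
    have h1 : ∀ n, ∫ ω, |M n ω| ^ p ∂P ≤
        6 * (K * ∫ ω, ∑ k ∈ Finset.range n, |e k ω| ^ p ∂P) := fun n => by
      induction n with
      | zero => simp [hM, Real.zero_rpow hp0.ne']
      | succ n ih =>
        simp only [Finset.sum_range_succ]
        rw [integral_add (integrable_finsetSum _ fun k _ => hei k) (hei n)]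
        linarith [hstep n]
    refine (h1 n).trans ?_
    gcongr
    calc _ ≤ ∫ _, R ∂P := integral_mono (integrable_finsetSum _ fun k _ => hei k)
            (integrable_const R) fun ω => hsum n ω
      _ = R := by simp
  -- The L^p bound gives an L¹ bound through |M| ≤ 1 + |M|^p, and Doob's theorem applies.
  refine hmartM.submartingale.exists_ae_tendsto_of_bdd (R := (1 + 6 * (K * R)).toNNReal)
    fun n => ?_
  have hi := (hML n).integrable hp1e
  rw [eLpNorm_one_eq_lintegral_enorm, ← ofReal_integral_norm_eq_lintegral_enorm hi]
  refine ENNReal.ofReal_le_ofReal ?_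
  calc ∫ ω, ‖M n ω‖ ∂P ≤ ∫ ω, (1 + |M n ω| ^ p) ∂P := by
        refine integral_mono hi.norm ((integrable_const 1).add (hint (hML n))) fun ω => ?_
        simp only [Real.norm_eq_abs]
        rcases le_total |M n ω| 1 with h | h
        · have : 0 ≤ |M n ω| ^ p := by positivity
          linarith
        · linarith [Real.self_le_rpow_of_one_le h hp1.le]
    _ ≤ _ := by
        rw [integral_add (integrable_const 1) (hint (hML n))]
        simpa using hbd n

/-- Local convergence of martingale transforms under conditional moment bounds. -/
theorem ae_tendsto_weighted_sum (hp1 : 1 < p) (hp2 : p ≤ 2)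
    (hε : ∀ n, Measurable[ℱ (n + 1)] (ε n)) (hmart : ∀ n, P[ε n | ℱ n] =ᵐ[P] 0)
    (hmom : ∀ n, CondMomentLE P (ℱ n) p K (ε n))
    {d : ℕ → Ω → ℝ} (hd : ∀ n, Measurable[ℱ n] (d n)) :
    ∀ᵐ ω ∂P, Summable (fun n => |d n ω| ^ p) →
      ∃ c, Tendsto (fun n => ∑ k ∈ Finset.range n, d k ω * ε k ω) atTop (𝓝 c) := by
  have hp0 : 0 < p := by linarith
  set D : ℕ → Ω → ℝ := fun n ω => ∑ k ∈ Finset.range n, |d k ω| ^ p with hD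
  have hDm : ∀ n, Measurable[ℱ n] (D (n + 1)) := fun n =>
    Finset.measurable_fun_sum _ fun k hk =>
      (by fun_prop : Measurable fun x : ℝ => |x| ^ p).comp
        ((hd k).mono (ℱ.mono (Nat.lt_succ_iff.1 (Finset.mem_range.1 hk))) le_rfl)
  have hDmono : ∀ ω, Monotone (D · ω) := fun ω => monotone_nat_of_le_succ fun n => by
    simp only [hD, Finset.sum_range_succ]
    have : 0 ≤ |d n ω| ^ p := by positivity
    linarith
  -- Truncation at level `R`. `D (n + 1)` involves only d_0, …, d_n, so the truncated weights remain
  -- predictable; on paths where the series sums to at most `R` nothing is cut.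
  set e : ℕ → ℕ → Ω → ℝ := fun R n => {ω | D (n + 1) ω ≤ R}.indicator (d n) with he
  have hem : ∀ R n, Measurable[ℱ n] (e R n) := fun R n =>
    (hd n).indicator (measurableSet_le (hDm n) measurable_const)
  have hes : ∀ R n ω, ∑ k ∈ Finset.range n, |e R k ω| ^ p ≤ R := fun R n ω => by
    have h1 : ∀ k, |e R k ω| ^ p ≤ |d k ω| ^ p := fun k => by
      simp only [he, Set.indicator_apply]
      split_ifs
      · exact le_rfl
      · simp only [abs_zero, Real.zero_rpow hp0.ne']
        positivity
    induction n with
    | zero => simp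
    | succ n ih =>
      by_cases h : D (n + 1) ω ≤ R
      · exact (Finset.sum_le_sum fun k _ => h1 k).trans h
      · rw [Finset.sum_range_succ]
        simpa [he, h, Real.zero_rpow hp0.ne'] using ih
  have hae := ae_all_iff.2 fun R : ℕ =>
    ae_tendsto_weighted_sum_of_bdd hp1 hp2 hε hmart hmom (hem R) (hes R)
  filter_upwards [hae] with ω hω hs
  obtain ⟨R, hR⟩ := exists_nat_ge (∑' n, |d n ω| ^ p)
  obtain ⟨c, hc⟩ := hω R
  refine ⟨c, hc.congr fun n => Finset.sum_congr rfl fun k _ => ?_⟩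
  have : D (k + 1) ω ≤ R := (hs.sum_le_tsum _ fun i _ => by positivity).trans hR
  simp [he, this]

end Martingale

/-! ### Kronecker and Abel–Dini lemmas -/

/-- Summation by parts bound in the spirit of Kronecker's lemma. -/
theorem exists_abs_sum_mul_le {x B : ℕ → ℝ} {c : ℝ} (hB : Monotone B) (hB0 : ∀ n, 0 ≤ B n)
    (hx : Tendsto (fun n => ∑ k ∈ Finset.range n, x k) atTop (𝓝 c)) {δ : ℝ} (hδ : 0 < δ) :
    ∃ C, ∀ n, |∑ k ∈ Finset.range (n + 1), B k * x k| ≤ δ * B n + C := by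
  set t : ℕ → ℝ := fun n => c - ∑ k ∈ Finset.range n, x k with ht
  have htx : ∀ n, x n = t n - t (n + 1) := fun n => by simp [ht, Finset.sum_range_succ]
  have ht0 : Tendsto t atTop (𝓝 0) := by simpa [ht] using hx.const_sub c
  obtain ⟨N, hN⟩ := (Metric.tendsto_atTop.1 ht0) (δ / 2) (by linarith)
  have hN' : ∀ n ≥ N, |t n| ≤ δ / 2 := fun n hn => by
    have := hN n hn
    rw [Real.dist_eq, sub_zero] at this
    exact this.le
  -- Abel summation against the tails `t`: beyond `N` each increment of `Y` is at most δ/2 times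
  -- that of `B`, and the boundary term B·t costs the other δ/2. No divergence of `B` is needed, at
  -- the price of the constant.
  set Y : ℕ → ℝ := fun n => ∑ k ∈ Finset.range (n + 1), B k * x k + B n * t (n + 1) with hY
  have hYs : ∀ n, Y (n + 1) = Y n + (B (n + 1) - B n) * t (n + 1) := fun n => by
    simp only [hY]
    rw [Finset.sum_range_succ _ (n + 1), htx (n + 1)]
    ring
  have hYb : ∀ n, |Y (N + n)| ≤ |Y N| + δ / 2 * (B (N + n) - B N) := fun n => by
    induction n with
    | zero => simp
    | succ n ih =>
      rw [← add_assoc, hYs]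
      have h1 : 0 ≤ B (N + n + 1) - B (N + n) := sub_nonneg.2 (hB (Nat.le_succ _))
      have h2 := hN' (N + n + 1) (by omega)
      calc _ ≤ |Y (N + n)| + |(B (N + n + 1) - B (N + n)) * t (N + n + 1)| := abs_add_le _ _
        _ ≤ |Y (N + n)| + (B (N + n + 1) - B (N + n)) * (δ / 2) := by
          rw [abs_mul, abs_of_nonneg h1]; gcongr
        _ ≤ _ := by linarith
  refine ⟨|Y N| + ∑ n ∈ Finset.range N, |∑ k ∈ Finset.range (n + 1), B k * x k|, fun n => ?_⟩
  have hs0 : 0 ≤ ∑ n ∈ Finset.range N, |∑ k ∈ Finset.range (n + 1), B k * x k| := by positivity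
  have hb := hB0 n
  rcases lt_or_ge n N with h | h
  · have h1 := Finset.single_le_sum (f := fun n => |∑ k ∈ Finset.range (n + 1), B k * x k|)
      (fun i _ => abs_nonneg _) (Finset.mem_range.2 h)
    have : 0 ≤ δ * B n := by positivity
    linarith [abs_nonneg (Y N)]
  · obtain ⟨j, rfl⟩ := Nat.exists_eq_add_of_le h
    have h1 := hYb j
    have h2 : ∑ k ∈ Finset.range (N + j + 1), B k * x k = Y (N + j) - B (N + j) * t (N + j + 1) := by
      simp [hY]
    have h3 := hN' (N + j + 1) (by omega)
    have h4 : |B (N + j) * t (N + j + 1)| ≤ B (N + j) * (δ / 2) := by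
      rw [abs_mul, abs_of_nonneg hb]; gcongr
    have h5 : 0 ≤ δ / 2 * B N := mul_nonneg (by linarith) (hB0 N)
    rw [h2]
    calc _ ≤ |Y (N + j)| + |B (N + j) * t (N + j + 1)| := abs_sub _ _
      _ ≤ _ := by linarith

/-- Abel–Dini: with C_n = 1 + ∑_{k<n} c_k and s = p − 1, each term is at most s⁻¹(C_n^{−s} −
C_{n+1}^{−s}), which telescopes. -/
theorem summable_div_one_add_sum_rpow {c : ℕ → ℝ} (hc : ∀ n, 0 ≤ c n) {p : ℝ} (hp : 1 < p) :
    Summable fun n => c n / (1 + ∑ k ∈ Finset.range (n + 1), c k) ^ p := by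
  set s := p - 1 with hs
  have hs0 : 0 < s := by linarith
  set C : ℕ → ℝ := fun n => 1 + ∑ k ∈ Finset.range n, c k with hC
  have hC1 : ∀ n, 1 ≤ C n := fun n => by
    have : 0 ≤ ∑ k ∈ Finset.range n, c k := Finset.sum_nonneg fun k _ => hc k
    simp only [hC]; linarith
  have hCs : ∀ n, C (n + 1) = C n + c n := fun n => by simp [hC, Finset.sum_range_succ]; ring
  have hstep : ∀ n, c n / C (n + 1) ^ p ≤ s⁻¹ * (C n ^ (-s) - C (n + 1) ^ (-s)) := fun n => by
    have h0 : 0 < C n := by linarith [hC1 n]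
    have h1 : 0 < C (n + 1) := by linarith [hC1 (n + 1)]
    have h2 : 1 + s * (c n / C (n + 1)) ≤ (C n / C (n + 1)) ^ (-s) := by
      have h3 : Real.log (C n / C (n + 1)) ≤ C n / C (n + 1) - 1 :=
        Real.log_le_sub_one_of_pos (by positivity)
      have h4 : C n / C (n + 1) - 1 = -(c n / C (n + 1)) := by
        rw [hCs]; rw [hCs] at h1; field_simp; ring
      rw [Real.rpow_def_of_pos (by positivity)]
      refine le_trans ?_ (Real.add_one_le_exp _)
      nlinarith
    have h5 : C (n + 1) ^ p = C (n + 1) ^ s * C (n + 1) := by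
      rw [← Real.rpow_add_one h1.ne']; simp [hs]
    have h6 : C n ^ (-s) = C (n + 1) ^ (-s) * (C n / C (n + 1)) ^ (-s) := by
      rw [← Real.mul_rpow h1.le (by positivity)]; congr 1; field_simp
    have h7 : c n / C (n + 1) ^ p = C (n + 1) ^ (-s) * (c n / C (n + 1)) := by
      rw [h5, Real.rpow_neg h1.le]; field_simp
    rw [h7, h6, inv_mul_eq_div, le_div_iff₀ hs0]
    have h8 : 0 < C (n + 1) ^ (-s) := by positivity
    nlinarith
  refine summable_of_sum_range_le (c := s⁻¹) (fun n => div_nonneg (hc n) (by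
    have := hC1 (n + 1); positivity)) fun n => ?_
  calc _ ≤ ∑ i ∈ Finset.range n, s⁻¹ * (C i ^ (-s) - C (i + 1) ^ (-s)) :=
        Finset.sum_le_sum fun i _ => hstep i
    _ = s⁻¹ * (C 0 ^ (-s) - C n ^ (-s)) := by
        rw [← Finset.mul_sum, Finset.sum_range_sub' fun i => C i ^ (-s)]
    _ ≤ s⁻¹ * 1 := by
        gcongr
        have h1 : C 0 ^ (-s) = 1 := by simp [hC]
        have h2 : 0 ≤ C n ^ (-s) := by have := hC1 n; positivity
        linarith
    _ = s⁻¹ := mul_one _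

/-! ### Strong law for martingale transforms -/

section Martingale

variable {P : Measure Ω} [IsProbabilityMeasure P] {ℱ : Filtration ℕ m0} {p : ℝ} {K : ℝ≥0}
  {ε : ℕ → Ω → ℝ}

/-- Strong law for martingale transforms: `∑ d k * ε k` is negligible with respect to `∑ c k`
whenever `|d k| ^ p ≤ c k`, up to an additive constant. -/
theorem ae_exists_abs_weighted_sum_le (hp1 : 1 < p) (hp2 : p ≤ 2)
    (hε : ∀ n, Measurable[ℱ (n + 1)] (ε n)) (hmart : ∀ n, P[ε n | ℱ n] =ᵐ[P] 0)
    (hmom : ∀ n, CondMomentLE P (ℱ n) p K (ε n))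
    {c d : ℕ → Ω → ℝ} (hc : ∀ n, Measurable[ℱ n] (c n)) (hd : ∀ n, Measurable[ℱ n] (d n))
    (hdc : ∀ n ω, |d n ω| ^ p ≤ c n ω) :
    ∀ᵐ ω ∂P, ∀ δ > 0, ∃ C, ∀ n, |∑ k ∈ Finset.range n, d k ω * ε k ω| ≤
      δ * ∑ k ∈ Finset.range n, c k ω + C := by
  have hc0 : ∀ n ω, 0 ≤ c n ω := fun n ω => le_trans (by positivity) (hdc n ω)
  set B : ℕ → Ω → ℝ := fun n ω => 1 + ∑ k ∈ Finset.range (n + 1), c k ω with hB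
  have hB1 : ∀ n ω, 1 ≤ B n ω := fun n ω => by
    have : 0 ≤ ∑ k ∈ Finset.range (n + 1), c k ω := Finset.sum_nonneg fun k _ => hc0 k ω
    simp only [hB]; linarith
  have hBm : ∀ n, Measurable[ℱ n] (B n) := fun n =>
    measurable_const.add (Finset.measurable_fun_sum _ fun k hk =>
      (hc k).mono (ℱ.mono (Nat.lt_succ_iff.1 (Finset.mem_range.1 hk))) le_rfl)
  have hBmono : ∀ ω, Monotone (B · ω) := fun ω => monotone_nat_of_le_succ fun n => by
    simp only [hB]
    rw [Finset.sum_range_succ _ (n + 1)]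
    linarith [hc0 (n + 1) ω]
  have h := ae_tendsto_weighted_sum hp1 hp2 hε hmart hmom (d := fun n ω => d n ω / B n ω)
    fun n => (hd n).div (hBm n)
  filter_upwards [h] with ω hω δ hδ
  have hs : Summable fun n => |d n ω / B n ω| ^ p := by
    refine Summable.of_nonneg_of_le (fun n => by positivity) (fun n => ?_)
      (summable_div_one_add_sum_rpow (hc0 · ω) hp1)
    have hBn : 0 < B n ω := by linarith [hB1 n ω]
    rw [abs_div, abs_of_pos hBn, Real.div_rpow (abs_nonneg _) hBn.le]
    gcongr
    exact hdc n ω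
  obtain ⟨l, hl⟩ := hω hs
  obtain ⟨C, hC⟩ := exists_abs_sum_mul_le (hBmono ω) (fun n => by linarith [hB1 n ω]) hl hδ
  -- The 0 serves the empty sum, and the extra δ pays for the 1 inside `B`.
  refine ⟨max 0 (δ + C), fun n => ?_⟩
  rcases n with _ | n
  · simp
  have h1 := hC n
  have h2 : ∀ k, B k ω * (d k ω / B k ω * ε k ω) = d k ω * ε k ω := fun k => by
    have : B k ω ≠ 0 := by linarith [hB1 k ω]
    field_simp
  simp only [h2] at h1
  refine h1.trans ?_
  have := le_max_right 0 (δ + C)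
  simp only [hB]
  linarith

end Martingale
end SparseId
end

noncomputable section
namespace SparseId
open scoped ENNReal NNReal
open Matrix

/-! ### Rank-one updates of the Gram matrix -/

section LinearAlgebra

variable {r : ℕ}

theorem isHermitian_dotProduct_mulVec_comm {M : Matrix (Fin r) (Fin r) ℝ} (hM : M.IsHermitian)
    (a b : Fin r → ℝ) : a ⬝ᵥ M *ᵥ b = b ⬝ᵥ M *ᵥ a := by
  have hM' : Mᵀ = M := by
    rw [← conjTranspose_eq_transpose_of_trivial]; exact hM
  rw [dotProduct_mulVec, ← mulVec_transpose, hM', dotProduct_comm]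

theorem posSemidef_vecMulVec_self (x : Fin r → ℝ) : (vecMulVec x x).PosSemidef := by
  simpa using posSemidef_vecMulVec_self_star x

theorem det_sub_vecMulVec_self {M : Matrix (Fin r) (Fin r) ℝ} (hM : IsUnit M.det)
    (x : Fin r → ℝ) : (M - vecMulVec x x).det = M.det * (1 - x ⬝ᵥ M⁻¹ *ᵥ x) := by
  have h1 : M - vecMulVec x x = M + replicateCol Unit (-x) * replicateRow Unit x := by
    rw [← vecMulVec_eq, neg_vecMulVec, sub_eq_add_neg]
  have h2 : (1 + replicateRow Unit x * M⁻¹ * replicateCol Unit (-x)).det =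
      1 - x ⬝ᵥ M⁻¹ *ᵥ x := by
    rw [det_unique, Matrix.add_apply, one_apply_eq, Matrix.mul_assoc, sub_eq_add_neg,
      ← dotProduct_neg, ← mulVec_neg]
    rfl
  rw [h1, det_add_replicateCol_mul_replicateRow hM, h2]

/-- One step of the recursion for the normalized quadratic form `Sᵀ G⁻¹ S`. -/
theorem quadForm_inv_add_vecMulVec {G : Matrix (Fin r) (Fin r) ℝ} (hG : G.PosDef)
    (x S : Fin r → ℝ) (v : ℝ) :
    (S + v • x) ⬝ᵥ (G + vecMulVec x x)⁻¹ *ᵥ (S + v • x) =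
      S ⬝ᵥ G⁻¹ *ᵥ S
        - (x ⬝ᵥ G⁻¹ *ᵥ S) ^ 2 * (1 - x ⬝ᵥ (G + vecMulVec x x)⁻¹ *ᵥ x)
        + 2 * v * ((x ⬝ᵥ G⁻¹ *ᵥ S) * (1 - x ⬝ᵥ (G + vecMulVec x x)⁻¹ *ᵥ x))
        + (x ⬝ᵥ (G + vecMulVec x x)⁻¹ *ᵥ x) * v ^ 2 := by
  have hG' : (G + vecMulVec x x).PosDef := hG.add_posSemidef (posSemidef_vecMulVec_self x)
  set G' := G + vecMulVec x x with hG'def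
  set a := x ⬝ᵥ G'⁻¹ *ᵥ x with ha
  set t := G⁻¹ *ᵥ S with ht
  set m := x ⬝ᵥ t with hm
  -- Writing S through G'(G⁻¹S) expresses G'⁻¹S by G⁻¹S and G'⁻¹x alone, so no formula for G'⁻¹ is
  -- required.
  have hS : S = G' *ᵥ t - m • x := by
    rw [hG'def, add_mulVec, vecMulVec_mulVec, ht, mulVec_mulVec,
      mul_nonsing_inv _ hG.det_pos.ne'.isUnit]
    ext i
    simp [hm, ht, mul_comm]
  have hPS : G'⁻¹ *ᵥ S = t - m • G'⁻¹ *ᵥ x := by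
    conv_lhs => rw [hS]
    rw [mulVec_sub, mulVec_mulVec, nonsing_inv_mul _ hG'.det_pos.ne'.isUnit, mulVec_smul]
    simp
  have hxPS : x ⬝ᵥ G'⁻¹ *ᵥ S = m * (1 - a) := by
    rw [hPS, dotProduct_sub, dotProduct_smul, ← hm, ← ha, smul_eq_mul]; ring
  have hSPx : S ⬝ᵥ G'⁻¹ *ᵥ x = m * (1 - a) := by
    rw [isHermitian_dotProduct_mulVec_comm hG'.inv.1, hxPS]
  have hSPS : S ⬝ᵥ G'⁻¹ *ᵥ S = S ⬝ᵥ t - m ^ 2 * (1 - a) := by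
    conv_lhs => rw [hPS]
    rw [dotProduct_sub, dotProduct_smul, hSPx, smul_eq_mul]; ring
  rw [mulVec_add, mulVec_smul, add_dotProduct, dotProduct_add, dotProduct_add, dotProduct_smul,
    smul_dotProduct, smul_dotProduct, dotProduct_smul, hSPS, hSPx, hxPS, ← ha]
  simp only [smul_eq_mul]
  ring

theorem one_sub_leverage {G : Matrix (Fin r) (Fin r) ℝ} (hG : G.PosDef) (x : Fin r → ℝ) :
    1 - x ⬝ᵥ (G + vecMulVec x x)⁻¹ *ᵥ x = G.det / (G + vecMulVec x x).det := by
  have hG' : (G + vecMulVec x x).PosDef := hG.add_posSemidef (posSemidef_vecMulVec_self x)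
  have h := det_sub_vecMulVec_self hG'.det_pos.ne'.isUnit x
  rw [add_sub_cancel_right] at h
  rw [h, mul_div_cancel_left₀ _ hG'.det_pos.ne']

theorem leverage_nonneg {G : Matrix (Fin r) (Fin r) ℝ} (hG : G.PosDef) (x : Fin r → ℝ) :
    0 ≤ x ⬝ᵥ (G + vecMulVec x x)⁻¹ *ᵥ x := by
  have hG' : (G + vecMulVec x x).PosDef := hG.add_posSemidef (posSemidef_vecMulVec_self x)
  simpa using hG'.inv.posSemidef.dotProduct_mulVec_nonneg x

theorem leverage_le_one {G : Matrix (Fin r) (Fin r) ℝ} (hG : G.PosDef) (x : Fin r → ℝ) :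
    x ⬝ᵥ (G + vecMulVec x x)⁻¹ *ᵥ x ≤ 1 := by
  have hG' : (G + vecMulVec x x).PosDef := hG.add_posSemidef (posSemidef_vecMulVec_self x)
  have h := one_sub_leverage hG x
  have : 0 < G.det / (G + vecMulVec x x).det := div_pos hG.det_pos hG'.det_pos
  linarith

/-- The leverage is 1 − det G / det G' by `one_sub_leverage`, and 1 − s ≤ −log s. The bound
telescopes along the data. -/
theorem leverage_le_log_det {G : Matrix (Fin r) (Fin r) ℝ} (hG : G.PosDef) (x : Fin r → ℝ) :
    x ⬝ᵥ (G + vecMulVec x x)⁻¹ *ᵥ x ≤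
      Real.log (G + vecMulVec x x).det - Real.log G.det := by
  have hG' : (G + vecMulVec x x).PosDef := hG.add_posSemidef (posSemidef_vecMulVec_self x)
  have h := one_sub_leverage hG x
  have h0 : 0 < G.det / (G + vecMulVec x x).det := div_pos hG.det_pos hG'.det_pos
  have h1 := Real.log_le_sub_one_of_pos h0
  rw [Real.log_div hG.det_pos.ne' hG'.det_pos.ne'] at h1
  linarith

theorem measurable_det {Ω : Type*} {m : MeasurableSpace Ω} {G : Ω → Matrix (Fin r) (Fin r) ℝ}
    (hG : ∀ i j, Measurable fun ω => G ω i j) : Measurable fun ω => (G ω).det := by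
  simp only [det_apply]
  exact Finset.measurable_fun_sum _ fun σ _ =>
    (Finset.measurable_fun_prod _ fun i _ => hG _ _).const_smul _

theorem measurable_inv_apply {Ω : Type*} {m : MeasurableSpace Ω}
    {G : Ω → Matrix (Fin r) (Fin r) ℝ}
    (hG : ∀ i j, Measurable fun ω => G ω i j) (i j : Fin r) :
    Measurable fun ω => (G ω)⁻¹ i j := by
  simp only [inv_def, Ring.inverse_eq_inv', Matrix.smul_apply, adjugate_apply, smul_eq_mul]
  refine (measurable_det hG).inv.mul (measurable_det fun k l => ?_)
  simp only [updateRow_apply]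
  split_ifs
  · exact measurable_const
  · exact hG k l

theorem measurable_dotProduct_mulVec {Ω : Type*} {m : MeasurableSpace Ω}
    {M : Ω → Matrix (Fin r) (Fin r) ℝ} {x z : Ω → Fin r → ℝ}
    (hM : ∀ i j, Measurable fun ω => M ω i j) (hx : ∀ i, Measurable fun ω => x ω i)
    (hz : ∀ i, Measurable fun ω => z ω i) : Measurable fun ω => x ω ⬝ᵥ M ω *ᵥ z ω := by
  simp only [dotProduct, mulVec]
  exact Finset.measurable_fun_sum _ fun i _ => (hx i).mul
    (Finset.measurable_fun_sum _ fun j _ => (hM i j).mul (hz j))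

/-- The regularized Gram matrix `1 + ∑_{k<n} x_k x_kᵀ`. -/
def regGram (x : ℕ → Fin r → ℝ) (n : ℕ) : Matrix (Fin r) (Fin r) ℝ :=
  1 + ∑ k ∈ Finset.range n, vecMulVec (x k) (x k)

/-- The score vector `∑_{k<n} v_k x_k`. -/
def score (x : ℕ → Fin r → ℝ) (v : ℕ → ℝ) (n : ℕ) : Fin r → ℝ :=
  ∑ k ∈ Finset.range n, v k • x k

theorem regGram_succ (x : ℕ → Fin r → ℝ) (n : ℕ) :
    regGram x (n + 1) = regGram x n + vecMulVec (x n) (x n) := by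
  rw [regGram, Finset.sum_range_succ, ← add_assoc, regGram]

theorem score_succ (x : ℕ → Fin r → ℝ) (v : ℕ → ℝ) (n : ℕ) :
    score x v (n + 1) = score x v n + v n • x n := by
  rw [score, Finset.sum_range_succ, score]

theorem posDef_regGram (x : ℕ → Fin r → ℝ) (n : ℕ) : (regGram x n).PosDef :=
  PosDef.one.add_posSemidef (posSemidef_sum _ fun k _ => posSemidef_vecMulVec_self (x k))

/-- Telescopes `quadForm_inv_add_vecMulVec`. The nonnegative sum kept on the left is what later
absorbs the martingale term on the right. -/
theorem quadForm_score_eq (x : ℕ → Fin r → ℝ) (v : ℕ → ℝ) (n : ℕ) :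
    score x v n ⬝ᵥ (regGram x n)⁻¹ *ᵥ score x v n +
      ∑ k ∈ Finset.range n, (x k ⬝ᵥ (regGram x k)⁻¹ *ᵥ score x v k) ^ 2 *
        (1 - x k ⬝ᵥ (regGram x (k + 1))⁻¹ *ᵥ x k) =
      2 * ∑ k ∈ Finset.range n, (x k ⬝ᵥ (regGram x k)⁻¹ *ᵥ score x v k) *
        (1 - x k ⬝ᵥ (regGram x (k + 1))⁻¹ *ᵥ x k) * v k +
      ∑ k ∈ Finset.range n, (x k ⬝ᵥ (regGram x (k + 1))⁻¹ *ᵥ x k) * v k ^ 2 := by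
  induction n with
  | zero => simp [score]
  | succ n ih =>
    have h := quadForm_inv_add_vecMulVec (posDef_regGram x n) (x n) (score x v n) (v n)
    rw [← regGram_succ, ← score_succ] at h
    simp only [Finset.sum_range_succ]
    linarith

theorem sum_leverage_le_log_det (x : ℕ → Fin r → ℝ) (n : ℕ) :
    ∑ k ∈ Finset.range n, x k ⬝ᵥ (regGram x (k + 1))⁻¹ *ᵥ x k ≤
      Real.log (regGram x n).det := by
  induction n with
  | zero => simp [regGram]
  | succ n ih =>
    have h := leverage_le_log_det (posDef_regGram x n) (x n)
    rw [← regGram_succ] at h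
    rw [Finset.sum_range_succ]
    linarith

end LinearAlgebra

/-! ### The Lai–Wei bound -/

section Stochastic

variable {Ω : Type*} {m m0 : MeasurableSpace Ω} {P : Measure Ω} [IsProbabilityMeasure P]

theorem CondMomentLE.condExp_sq_le (hm : m ≤ m0) {K : ℝ≥0} {f : Ω → ℝ} (hf : Measurable f)
    (h : CondMomentLE P m 2 K f) : ∀ᵐ ω ∂P, (P[fun ω => f ω ^ 2 | m]) ω ≤ K := by
  have hL : MemLp f 2 P := by simpa using h.memLp (by norm_num) hf
  have hi : Integrable (fun ω => f ω ^ 2) P := hL.integrable_sq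
  refine ae_le_of_ae_le_trim (hm := hm) (f₂ := fun _ => (K : ℝ)) ?_
  refine ae_le_of_forall_setIntegral_le (integrable_condExp.trim hm stronglyMeasurable_condExp)
    (integrable_const _) fun s hs _ => ?_
  rw [← setIntegral_trim hm stronglyMeasurable_condExp hs, setIntegral_condExp hm hi hs,
    ← setIntegral_trim hm stronglyMeasurable_const hs, setIntegral_const, smul_eq_mul,
    integral_eq_lintegral_of_nonneg_ae (ae_of_all _ fun ω => sq_nonneg _) (by fun_prop)]
  have h1 := h s hs
  simp only [Real.rpow_two, sq_abs] at h1
  calc _ ≤ (K * P s).toReal :=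
        ENNReal.toReal_mono (ENNReal.mul_ne_top (by simp) (measure_ne_top _ _)) h1
    _ = _ := by rw [ENNReal.toReal_mul, ENNReal.coe_toReal, mul_comm]; rfl

theorem rpow_le_one_add_rpow {t : ℝ} (ht : 0 ≤ t) {p q : ℝ} (hp : 0 ≤ p) (hpq : p ≤ q) :
    t ^ p ≤ 1 + t ^ q := by
  rcases le_total t 1 with h | h
  · have h1 := Real.rpow_le_one ht h hp
    have h2 : 0 ≤ t ^ q := by positivity
    linarith
  · linarith [Real.rpow_le_rpow_of_exponent_le h hpq]

/-- The centred squares of a martingale difference with conditional moment of order `γ > 2`. -/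
theorem exists_condMomentLE_sq_sub {γ : ℝ} (hγ : 2 < γ) {p : ℝ} (hp1 : 1 < p) (hpγ : 2 * p ≤ γ)
    (hm : m ≤ m0) {K : ℝ≥0} {f : Ω → ℝ} (hf : Measurable f) (h : CondMomentLE P m γ K f) :
    CondMomentLE P m p (1 + (1 + K) ^ p + 1 * K)
      (fun ω => f ω ^ 2 - (P[fun ω => f ω ^ 2 | m]) ω) ∧
      ∀ᵐ ω ∂P, (P[fun ω => f ω ^ 2 | m]) ω ≤ 1 + K := by
  have h2 : CondMomentLE P m 2 (1 + 1 * K) f := h.mono (ae_of_all _ fun ω => by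
    simpa using rpow_le_one_add_rpow (abs_nonneg (f ω)) (by norm_num) hγ.le)
  have hle := h2.condExp_sq_le hm hf
  simp only [one_mul, NNReal.coe_add, NNReal.coe_one] at hle
  refine ⟨h.mono ?_, hle⟩
  have hnn : 0 ≤ᵐ[P] P[fun ω => f ω ^ 2 | m] := condExp_nonneg (ae_of_all _ fun ω => sq_nonneg _)
  filter_upwards [hle, hnn] with ω h1 h0
  simp only [Pi.zero_apply] at h0
  have hK : (0 : ℝ) ≤ 1 + K := by positivity
  have hpow : (|f ω| ^ 2) ^ p ≤ 1 + |f ω| ^ γ := by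
    rw [← Real.rpow_natCast, ← Real.rpow_mul (abs_nonneg _)]
    exact rpow_le_one_add_rpow (abs_nonneg _) (by positivity) (by simpa using hpγ)
  have hKp : (0 : ℝ) ≤ (1 + K) ^ p := by positivity
  have hfp : (0 : ℝ) ≤ (|f ω| ^ 2) ^ p := by positivity
  push_cast
  -- Both f² and its conditional mean are nonnegative and the mean is at most 1 + K, so their
  -- difference is at most max(f², 1 + K) in absolute value.
  rcases le_total (f ω ^ 2) (1 + K) with h3 | h3
  · have : |f ω ^ 2 - (P[fun ω => f ω ^ 2 | m]) ω| ≤ 1 + K :=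
      abs_le.2 ⟨by nlinarith [sq_nonneg (f ω)], by linarith⟩
    have := Real.rpow_le_rpow (abs_nonneg _) this (by linarith : 0 ≤ p)
    linarith
  · have : |f ω ^ 2 - (P[fun ω => f ω ^ 2 | m]) ω| ≤ |f ω| ^ 2 := by
      rw [sq_abs]
      exact abs_le.2 ⟨by nlinarith [sq_nonneg (f ω)], by linarith⟩
    have := Real.rpow_le_rpow (abs_nonneg _) this (by linarith : 0 ≤ p)
    linarith

/-- The Lai–Wei bound for noise with uniformly bounded conditional moments of order `γ > 2`. -/
theorem ae_exists_quadForm_score_le {r : ℕ} {ℱ : Filtration ℕ m0} {γ : ℝ} (hγ : 2 < γ) {K : ℝ≥0}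
    {x : ℕ → Ω → Fin r → ℝ} {v : ℕ → Ω → ℝ}
    (hx : ∀ n, Measurable[ℱ n] (x n)) (hv : ∀ n, Measurable[ℱ (n + 1)] (v n))
    (hmart : ∀ n, P[v n | ℱ n] =ᵐ[P] 0) (hmom : ∀ n, CondMomentLE P (ℱ n) γ K (v n)) :
    ∀ᵐ ω ∂P, ∃ C, ∀ n, score (x · ω) (v · ω) n ⬝ᵥ (regGram (x · ω) n)⁻¹ *ᵥ score (x · ω) (v · ω) n ≤
      C * (1 + Real.log (regGram (x · ω) n).det) := by
  set p := min (γ / 2) 2 with hp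
  have hp1 : 1 < p := lt_min (by linarith) (by norm_num)
  have hp2 : p ≤ 2 := min_le_right _ _
  have hpγ : 2 * p ≤ γ := by linarith [min_le_left (γ / 2) 2]
  have hv' : ∀ n, Measurable (v n) := fun n => (hv n).mono (ℱ.le _) le_rfl
  have hxi : ∀ {k n} (i : Fin r), k ≤ n → Measurable[ℱ n] fun ω => x k ω i := fun i hkn =>
    (measurable_pi_apply i).comp ((hx _).mono (ℱ.mono hkn) le_rfl)
  have hGm : ∀ n i j, Measurable[ℱ n] fun ω => regGram (x · ω) (n + 1) i j := fun n i j => by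
    simp only [regGram, Matrix.add_apply, Matrix.sum_apply, vecMulVec_apply]
    refine measurable_const.add (Finset.measurable_fun_sum _ fun k hk => ?_)
    have hkn := Nat.lt_succ_iff.1 (Finset.mem_range.1 hk)
    exact (hxi i hkn).mul (hxi j hkn)
  have hGm' : ∀ n i j, Measurable[ℱ n] fun ω => regGram (x · ω) n i j := fun n i j => by
    simp only [regGram, Matrix.add_apply, Matrix.sum_apply, vecMulVec_apply]
    refine measurable_const.add (Finset.measurable_fun_sum _ fun k hk => ?_)
    have hkn := (Finset.mem_range.1 hk).le
    exact (hxi i hkn).mul (hxi j hkn)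
  have hSm : ∀ n i, Measurable[ℱ n] fun ω => score (x · ω) (v · ω) n i := fun n i => by
    simp only [score, Finset.sum_apply, Pi.smul_apply, smul_eq_mul]
    refine Finset.measurable_fun_sum _ fun k hk => ?_
    have hkn := Finset.mem_range.1 hk
    exact ((hv k).mono (ℱ.mono hkn) le_rfl).mul (hxi i hkn.le)
  set a : ℕ → Ω → ℝ := fun n ω => x n ω ⬝ᵥ (regGram (x · ω) (n + 1))⁻¹ *ᵥ x n ω with ha
  set q : ℕ → Ω → ℝ := fun n ω =>
    x n ω ⬝ᵥ (regGram (x · ω) n)⁻¹ *ᵥ score (x · ω) (v · ω) n with hq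
  have ham : ∀ n, Measurable[ℱ n] (a n) := fun n =>
    measurable_dotProduct_mulVec (measurable_inv_apply (hGm n)) (fun i => hxi i le_rfl)
      (fun i => hxi i le_rfl)
  have hqm : ∀ n, Measurable[ℱ n] (q n) := fun n =>
    measurable_dotProduct_mulVec (measurable_inv_apply (hGm' n)) (fun i => hxi i le_rfl)
      (hSm n)
  have ha0 : ∀ n ω, 0 ≤ a n ω := fun n ω => by
    have := leverage_nonneg (posDef_regGram (x · ω) n) (x n ω)
    rwa [← regGram_succ (x · ω)] at this
  have ha1 : ∀ n ω, a n ω ≤ 1 := fun n ω => by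
    have := leverage_le_one (posDef_regGram (x · ω) n) (x n ω)
    rwa [← regGram_succ (x · ω)] at this
  have hsq := fun n => exists_condMomentLE_sq_sub hγ hp1 hpγ (ℱ.le n) (hv' n) (hmom n)
  have hv2 : ∀ n, CondMomentLE P (ℱ n) 2 (1 + 1 * K) (v n) := fun n =>
    (hmom n).mono (ae_of_all _ fun ω => by
      simpa using rpow_le_one_add_rpow (abs_nonneg (v n ω)) (by norm_num) hγ.le)
  have hvL : ∀ n, MemLp (v n) 2 P := fun n => by
    simpa using (hv2 n).memLp (by norm_num) (hv' n)
  set g : ℕ → Ω → ℝ := fun n => P[fun ω => v n ω ^ 2 | ℱ n] with hg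
  have hgm : ∀ n, Measurable[ℱ n] (g n) := fun n => stronglyMeasurable_condExp.measurable
  have hεmart : ∀ n, P[fun ω => v n ω ^ 2 - g n ω | ℱ n] =ᵐ[P] 0 := fun n => by
    have h1 : P[(fun ω => v n ω ^ 2) - g n | ℱ n] =ᵐ[P] _ :=
      condExp_sub (hvL n).integrable_sq integrable_condExp (ℱ n)
    have h2 : P[g n | ℱ n] = g n := condExp_of_stronglyMeasurable (ℱ.le n)
      stronglyMeasurable_condExp integrable_condExp
    rw [h2] at h1
    exact h1.trans (by simp [hg])
  -- Here c = d = a, admissible because 0 ≤ a ≤ 1 gives a^p ≤ a.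
  have hA := ae_exists_abs_weighted_sum_le (ε := fun n ω => v n ω ^ 2 - g n ω) hp1 hp2
    (fun n => ((hv n).pow_const 2).sub ((hgm n).mono (ℱ.mono n.le_succ) le_rfl)) hεmart
    (fun n => (hsq n).1) ham ham (fun n ω => by
      rw [abs_of_nonneg (ha0 n ω)]
      simpa using Real.rpow_le_rpow_of_exponent_ge' (ha0 n ω) (ha1 n ω) zero_le_one hp1.le)
  have hB := ae_exists_abs_weighted_sum_le (c := fun n ω => q n ω ^ 2 * (1 - a n ω))
    (d := fun n ω => q n ω * (1 - a n ω)) one_lt_two le_rfl hv hmart hv2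
    (fun n => ((hqm n).pow_const 2).mul (measurable_const.sub (ham n)))
    (fun n => (hqm n).mul (measurable_const.sub (ham n))) (fun n ω => by
      rw [Real.rpow_two, sq_abs, mul_pow]
      have h0 := ha0 n ω
      have h1 := ha1 n ω
      exact mul_le_mul_of_nonneg_left (by nlinarith) (sq_nonneg _))
  have hgle := ae_all_iff.2 fun n => (hsq n).2
  filter_upwards [hA, hB, hgle] with ω hAω hBω hgω
  obtain ⟨C₁, hC₁⟩ := hAω 1 one_pos
  -- The cross term enters `key` with factor 2, so δ = 1/2 makes it cancel exactly against the sum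
  -- on the left.
  obtain ⟨C₂, hC₂⟩ := hBω (1 / 2) (by norm_num)
  refine ⟨K + 2 + |C₁| + 2 * |C₂|, fun n => ?_⟩
  have key := quadForm_score_eq (x · ω) (v · ω) n
  have hlog := sum_leverage_le_log_det (x · ω) n
  have h1 := (le_abs_self _).trans (hC₁ n)
  have h2 := (le_abs_self _).trans (hC₂ n)
  have h3 : ∑ k ∈ Finset.range n, a k ω * v k ω ^ 2 ≤
      ∑ k ∈ Finset.range n, a k ω * (v k ω ^ 2 - g k ω) +
        (1 + K) * ∑ k ∈ Finset.range n, a k ω := by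
    rw [Finset.mul_sum, ← Finset.sum_add_distrib]
    refine Finset.sum_le_sum fun k _ => ?_
    nlinarith [hgω k, ha0 k ω]
  have h4 : 0 ≤ ∑ k ∈ Finset.range n, a k ω := Finset.sum_nonneg fun k _ => ha0 k ω
  change _ + ∑ k ∈ Finset.range n, q k ω ^ 2 * (1 - a k ω) =
    2 * ∑ k ∈ Finset.range n, q k ω * (1 - a k ω) * v k ω +
      ∑ k ∈ Finset.range n, a k ω * v k ω ^ 2 at key
  change ∑ k ∈ Finset.range n, a k ω ≤ _ at hlog
  have hc1 := le_abs_self C₁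
  have hc2 := le_abs_self C₂
  set L := Real.log (regGram (x · ω) n).det
  have hK0 : (0 : ℝ) ≤ K := K.2
  have h5 : ((K : ℝ) + 2) * ∑ k ∈ Finset.range n, a k ω ≤ (K + 2) * L := by gcongr
  have h6 : 0 ≤ (|C₁| + 2 * |C₂|) * L := mul_nonneg (by positivity) (h4.trans hlog)
  nlinarith

/-- The Lai–Wei bound when the conditional moments of order `γ > 2` are almost surely bounded. -/
theorem ae_exists_quadForm_score_le_of_iSup_lt_top {r : ℕ} {ℱ : Filtration ℕ m0} {γ : ℝ}
    (hγ : 2 < γ) {x : ℕ → Ω → Fin r → ℝ} {v : ℕ → Ω → ℝ}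
    (hx : ∀ n, Measurable[ℱ n] (x n)) (hv : ∀ n, Measurable[ℱ (n + 1)] (v n))
    (hint : ∀ n, Integrable (v n) P) (hmart : ∀ n, P[v n | ℱ n] =ᵐ[P] 0)
    (hmom : ∀ᵐ ω ∂P,
      ⨆ n, condLExp (ℱ n) P (fun ω => ENNReal.ofReal (|v n ω| ^ γ)) ω < ⊤) :
    ∀ᵐ ω ∂P, ∃ C, ∀ n, score (x · ω) (v · ω) n ⬝ᵥ (regGram (x · ω) n)⁻¹ *ᵥ score (x · ω) (v · ω) n ≤
      C * (1 + Real.log (regGram (x · ω) n).det) := by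
  set q : ℕ → Ω → ℝ≥0∞ := fun n => condLExp (ℱ n) P (fun ω => ENNReal.ofReal (|v n ω| ^ γ)) with hq
  -- Localization: `J R n` is known at time n, so cutting the noise off outside it keeps the
  -- martingale difference property and bounds the conditional moment by `R`. Almost every path lies
  -- in all `J R n` for some integer `R`.
  set J : ℕ → ℕ → Set Ω := fun R n => ⋂ j ∈ Set.Iic n, {ω | q j ω ≤ R} with hJ
  have hJm : ∀ R n, MeasurableSet[ℱ n] (J R n) := fun R n =>
    MeasurableSet.biInter (Set.to_countable _) fun j hj =>
      measurableSet_le ((measurable_condLExp _ _ _).mono (ℱ.mono hj) le_rfl) measurable_const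
  have hloc : ∀ R : ℕ, ∀ᵐ ω ∂P, ∃ C, ∀ n,
      score (x · ω) (fun n => (J R n).indicator (v n) ω) n ⬝ᵥ (regGram (x · ω) n)⁻¹ *ᵥ
        score (x · ω) (fun n => (J R n).indicator (v n) ω) n ≤
      C * (1 + Real.log (regGram (x · ω) n).det) := fun R => by
    refine ae_exists_quadForm_score_le (v := fun n => (J R n).indicator (v n)) hγ (K := R) hx
      (fun n => (hv n).indicator (ℱ.mono n.le_succ _ (hJm R n))) (fun n => ?_) fun n s hs => ?_
    · filter_upwards [condExp_indicator (hint n) (hJm R n), hmart n] with ω h1 h2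
      rw [h1]
      by_cases h : ω ∈ J R n <;> simp [h, h2]
    · have hγ0 : γ ≠ 0 := by linarith
      have h1 : ∀ ω, ENNReal.ofReal (|(J R n).indicator (v n) ω| ^ γ) =
          (J R n).indicator (fun ω => ENNReal.ofReal (|v n ω| ^ γ)) ω := fun ω => by
        by_cases h : ω ∈ J R n <;> simp [h, Real.zero_rpow hγ0]
      simp only [h1]
      rw [setLIntegral_indicator (ℱ.le n _ (hJm R n)),
        ← setLIntegral_condLExp (ℱ.le n) P _ ((hJm R n).inter hs)]
      calc _ ≤ ∫⁻ _ in J R n ∩ s, (R : ℝ≥0∞) ∂P :=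
            setLIntegral_mono measurable_const fun ω hω => Set.mem_iInter₂.1 hω.1 n (Set.mem_Iic.2 le_rfl)
        _ = R * P (J R n ∩ s) := by simp
        _ ≤ _ := by
          simp only [ENNReal.coe_natCast]
          gcongr
          exact Set.inter_subset_right
  filter_upwards [ae_all_iff.2 hloc, hmom] with ω h1 h2
  obtain ⟨R, hR⟩ := ENNReal.exists_nat_gt h2.ne
  have h3 : ∀ n, (J R n).indicator (v n) ω = v n ω := fun n =>
    Set.indicator_of_mem (Set.mem_iInter₂.2 fun j _ =>
      (le_iSup (fun n => q n ω) j).trans hR.le) _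
  simpa only [h3] using h1 R

end Stochastic

end SparseId
end

noncomputable section
namespace SparseId
open scoped ENNReal NNReal
open Matrix

/-! ### Extreme eigenvalues and quadratic forms -/

section Spectral

variable {r : ℕ} {M : Matrix (Fin r) (Fin r) ℝ}

theorem finite_spectrum_of_isHermitian (hM : M.IsHermitian) : (spectrum ℝ M).Finite := by
  rw [hM.spectrum_real_eq_range_eigenvalues]
  exact Set.finite_range _

theorem le_of_mem_spectrum_of_posSemidef {c : ℝ} (h : (c • 1 - M).PosSemidef) {μ : ℝ}
    (hμ : μ ∈ spectrum ℝ M) : μ ≤ c := by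
  have h1 := (posSemidef_iff_isHermitian_and_spectrum_nonneg.1 h).2
  rw [← Algebra.algebraMap_eq_smul_one, ← spectrum.singleton_sub_eq] at h1
  have := h1 (Set.sub_mem_sub rfl hμ)
  simpa using this

theorem ge_of_mem_spectrum_of_posSemidef {c : ℝ} (h : (M - c • 1).PosSemidef) {μ : ℝ}
    (hμ : μ ∈ spectrum ℝ M) : c ≤ μ := by
  have h1 := (posSemidef_iff_isHermitian_and_spectrum_nonneg.1 h).2
  rw [← Algebra.algebraMap_eq_smul_one, ← spectrum.sub_singleton_eq] at h1
  have := h1 (Set.sub_mem_sub hμ rfl)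
  simpa using this

theorem posSemidef_eigMax_smul_one_sub (hM : M.IsHermitian) : (eigMax M • 1 - M).PosSemidef := by
  refine posSemidef_iff_isHermitian_and_spectrum_nonneg.2
    ⟨(isHermitian_one.smul (IsSelfAdjoint.all _)).sub hM, ?_⟩
  rw [← Algebra.algebraMap_eq_smul_one, ← spectrum.singleton_sub_eq]
  rintro _ ⟨_, rfl, μ, hμ, rfl⟩
  exact sub_nonneg.2 (le_csSup (finite_spectrum_of_isHermitian hM).bddAbove hμ)

theorem posSemidef_sub_eigMin_smul_one (hM : M.IsHermitian) : (M - eigMin M • 1).PosSemidef := by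
  refine posSemidef_iff_isHermitian_and_spectrum_nonneg.2
    ⟨hM.sub (isHermitian_one.smul (IsSelfAdjoint.all _)), ?_⟩
  rw [← Algebra.algebraMap_eq_smul_one, ← spectrum.sub_singleton_eq]
  rintro _ ⟨μ, hμ, _, rfl, rfl⟩
  exact sub_nonneg.2 (csInf_le (finite_spectrum_of_isHermitian hM).bddBelow hμ)

theorem dotProduct_mulVec_le_eigMax (hM : M.IsHermitian) (x : Fin r → ℝ) :
    x ⬝ᵥ M *ᵥ x ≤ eigMax M * (x ⬝ᵥ x) := by
  have := (posSemidef_eigMax_smul_one_sub hM).dotProduct_mulVec_nonneg x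
  simp [sub_mulVec, smul_mulVec, dotProduct_sub] at this
  linarith

theorem eigMin_mul_le_dotProduct_mulVec (hM : M.IsHermitian) (x : Fin r → ℝ) :
    eigMin M * (x ⬝ᵥ x) ≤ x ⬝ᵥ M *ᵥ x := by
  have := (posSemidef_sub_eigMin_smul_one hM).dotProduct_mulVec_nonneg x
  simp [sub_mulVec, smul_mulVec, dotProduct_sub] at this
  linarith

theorem eigMin_le_eigMax (hM : M.IsHermitian) : eigMin M ≤ eigMax M :=
  Real.sInf_le_sSup _ (finite_spectrum_of_isHermitian hM).bddBelow
    (finite_spectrum_of_isHermitian hM).bddAbove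

theorem posDef_of_eigMin_pos (hM : M.IsHermitian) (h : 0 < eigMin M) : M.PosDef := by
  have := (PosDef.one (n := Fin r) (R := ℝ)).smul h |>.add_posSemidef
    (posSemidef_sub_eigMin_smul_one hM)
  rwa [add_sub_cancel] at this

theorem eigMax_nonneg (hM : M.PosSemidef) : 0 ≤ eigMax M :=
  Real.sSup_nonneg fun _ hμ => (posSemidef_iff_isHermitian_and_spectrum_nonneg.1 hM).2 hμ

theorem eigMax_mono {M' : Matrix (Fin r) (Fin r) ℝ} (hM : M.PosSemidef)
    (hMM' : (M' - M).PosSemidef) : eigMax M ≤ eigMax M' := by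
  have hM' : M'.PosSemidef := by simpa using hM.add hMM'
  -- Nonnegativity of the bound covers r = 0, where the spectrum is empty and its supremum is 0 by
  -- convention.
  refine Real.sSup_le (fun μ hμ => le_of_mem_spectrum_of_posSemidef ?_ hμ) (eigMax_nonneg hM')
  simpa using (posSemidef_eigMax_smul_one_sub hM'.1).add hMM'

theorem det_one_add_le (hM : M.PosSemidef) : (1 + M).det ≤ (1 + eigMax M) ^ r := by
  have h1 : (1 + M).PosSemidef := PosSemidef.one.add hM
  rw [h1.1.det_eq_prod_eigenvalues]
  calc _ ≤ ∏ _i : Fin r, (1 + eigMax M) := by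
        refine Finset.prod_le_prod (fun i _ => h1.eigenvalues_nonneg i) fun i _ => ?_
        refine le_of_mem_spectrum_of_posSemidef ?_ (h1.1.eigenvalues_mem_spectrum_real i)
        have := posSemidef_eigMax_smul_one_sub hM.1
        rwa [add_smul, one_smul, add_sub_add_left_eq_sub]
    _ = _ := by simp

theorem one_le_det_one_add (hM : M.PosSemidef) : 1 ≤ (1 + M).det := by
  have h1 : (1 + M).PosSemidef := PosSemidef.one.add hM
  rw [h1.1.det_eq_prod_eigenvalues]
  calc (1 : ℝ) = ∏ _i : Fin r, 1 := by simp
    _ ≤ _ := Finset.prod_le_prod (fun _ _ => zero_le_one) fun i _ =>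
      ge_of_mem_spectrum_of_posSemidef (by rwa [one_smul, add_sub_cancel_left])
        (h1.1.eigenvalues_mem_spectrum_real i)

theorem two_mul_dotProduct_mulVec_le (hM : M.PosSemidef) {s : ℝ} (hs : 0 < s) (a b : Fin r → ℝ) :
    2 * (a ⬝ᵥ M *ᵥ b) ≤ s * (a ⬝ᵥ M *ᵥ a) + s⁻¹ * (b ⬝ᵥ M *ᵥ b) := by
  have h := hM.dotProduct_mulVec_nonneg (s • a - b)
  have hc := isHermitian_dotProduct_mulVec_comm hM.1 b a
  simp [mulVec_sub, mulVec_smul, dotProduct_sub, sub_dotProduct, hc] at h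
  have h1 : s⁻¹ * (s * (s * (a ⬝ᵥ M *ᵥ a) - a ⬝ᵥ M *ᵥ b) - (s * (a ⬝ᵥ M *ᵥ b) - b ⬝ᵥ M *ᵥ b)) =
      s * (a ⬝ᵥ M *ᵥ a) + s⁻¹ * (b ⬝ᵥ M *ᵥ b) - 2 * (a ⬝ᵥ M *ᵥ b) := by
    field_simp; ring
  have h2 : 0 ≤ s⁻¹ * (s * (s * (a ⬝ᵥ M *ᵥ a) - a ⬝ᵥ M *ᵥ b) -
      (s * (a ⬝ᵥ M *ᵥ b) - b ⬝ᵥ M *ᵥ b)) := mul_nonneg (by positivity) (by linarith)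
  linarith

/-- Expand the nonnegative form of `M` at a − M⁻¹S. -/
theorem le_dotProduct_inv_mulVec (hM : M.PosDef) (a S : Fin r → ℝ) :
    2 * (a ⬝ᵥ S) - a ⬝ᵥ M *ᵥ a ≤ S ⬝ᵥ M⁻¹ *ᵥ S := by
  have h := two_mul_dotProduct_mulVec_le hM.posSemidef one_pos a (M⁻¹ *ᵥ S)
  rw [mulVec_mulVec, mul_nonsing_inv _ hM.det_pos.ne'.isUnit, one_mulVec,
    dotProduct_comm (M⁻¹ *ᵥ S)] at h
  linarith

/-- With `S = M e` and `M ≥ 1`, the form `eᵀ M e` is controlled by `Sᵀ (1 + M)⁻¹ S`. -/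
theorem dotProduct_mulVec_le_two_mul (hM : M.PosSemidef) (h1 : 1 ≤ eigMin M) (e : Fin r → ℝ) :
    e ⬝ᵥ M *ᵥ e ≤ 2 * ((M *ᵥ e) ⬝ᵥ (1 + M)⁻¹ *ᵥ (M *ᵥ e)) := by
  -- At a = e/2 the lower bound is eᵀMe − (eᵀe + eᵀMe)/4, at least half of eᵀMe because eᵀe ≤ eᵀMe.
  have h := le_dotProduct_inv_mulVec ((PosDef.one (n := Fin r) (R := ℝ)).add_posSemidef hM)
    ((1 / 2 : ℝ) • e) (M *ᵥ e)
  have h2 := eigMin_mul_le_dotProduct_mulVec hM.1 e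
  have h3 : 0 ≤ e ⬝ᵥ e := by simpa using dotProduct_star_self_nonneg e
  simp [add_mulVec, mulVec_smul, dotProduct_add, -mulVec_mulVec] at h
  nlinarith

end Spectral

/-! ### Least squares and the penalized criterion along one path -/

section Deterministic

variable {r : ℕ} {x : ℕ → Fin r → ℝ} {z : ℕ → ℝ}

theorem posSemidef_gram (x : ℕ → Fin r → ℝ) (N : ℕ) : (gram x N).PosSemidef :=
  posSemidef_sum _ fun k _ => posSemidef_vecMulVec_self (x k)

theorem lamMax_mono (x : ℕ → Fin r → ℝ) : Monotone (lamMax x) :=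
  monotone_nat_of_le_succ fun N => eigMax_mono (posSemidef_gram x N) (by
    simp only [gram]
    rw [Finset.sum_Icc_succ_top (by omega), add_sub_cancel_left]
    exact posSemidef_vecMulVec_self _)

theorem gram_mulVec_lsEstimate {N : ℕ} (h : 0 < lamMin x N) :
    gram x N *ᵥ lsEstimate x z N = ∑ k ∈ Finset.Icc 1 N, z (k + 1) • x k := by
  have hG := posDef_of_eigMin_pos (posSemidef_gram x N).1 h
  rw [lsEstimate, mulVec_mulVec, mul_nonsing_inv _ hG.det_pos.ne'.isUnit, one_mulVec]

theorem gram_mulVec (x : ℕ → Fin r → ℝ) (N : ℕ) (b : Fin r → ℝ) :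
    gram x N *ᵥ b = ∑ k ∈ Finset.Icc 1 N, (b ⬝ᵥ x k) • x k := by
  rw [gram, sum_mulVec]
  refine Finset.sum_congr rfl fun k _ => ?_
  rw [vecMulVec_mulVec, dotProduct_comm]
  ext i
  simp [mul_comm]

/-- Expansion around an arbitrary `b`; the normal equations turn the cross term into one with the
least squares estimate. -/
theorem sum_sq_add {N : ℕ} (h : 0 < lamMin x N) (b d : Fin r → ℝ) :
    ∑ k ∈ Finset.Icc 1 N, (z (k + 1) - (b + d) ⬝ᵥ x k) ^ 2 =
      ∑ k ∈ Finset.Icc 1 N, (z (k + 1) - b ⬝ᵥ x k) ^ 2 + d ⬝ᵥ gram x N *ᵥ d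
        - 2 * (d ⬝ᵥ gram x N *ᵥ (lsEstimate x z N - b)) := by
  rw [mulVec_sub, gram_mulVec_lsEstimate h, gram_mulVec, gram_mulVec, ← Finset.sum_sub_distrib,
    dotProduct_sum, dotProduct_sum, Finset.mul_sum, ← Finset.sum_add_distrib,
    ← Finset.sum_sub_distrib]
  refine Finset.sum_congr rfl fun k _ => ?_
  simp only [add_dotProduct, dotProduct_smul, dotProduct_sub, smul_eq_mul]
  ring

theorem abs_modEstimate (x : ℕ → Fin r → ℝ) (z : ℕ → ℝ) (N : ℕ) (j : Fin r) :
    |modEstimate x z N j| = |lsEstimate x z N j| + rate x N := by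
  have h0 : 0 ≤ rate x N := Real.sqrt_nonneg _
  rw [modEstimate, sgn]
  split_ifs with h
  · rw [one_mul, abs_of_nonneg (add_nonneg h h0), abs_of_nonneg h]
  · rw [abs_of_neg (by linarith), abs_of_neg (by linarith)]; ring

theorem abs_apply_le_sqrt_dotProduct_self (a : Fin r → ℝ) (j : Fin r) :
    |a j| ≤ √(a ⬝ᵥ a) := by
  refine Real.abs_le_sqrt ?_
  rw [sq]
  exact Finset.single_le_sum (f := fun i => a i * a i) (fun i _ => mul_self_nonneg _)
    (Finset.mem_univ j)

/-- The penalized estimate stays close to the parameter as soon as the least squares error does. -/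
theorem lamMin_mul_dotProduct_sub_le {N : ℕ} (hpos : 0 < lamMin x N) {c : ℝ} (hc : 0 ≤ c)
    {θ b : Fin r → ℝ} (hb : criterion x z c N b ≤ criterion x z c N θ)
    (hmod : ∀ l, θ l ≠ 0 → |θ l| / 2 ≤ |modEstimate x z N l|) :
    lamMin x N * ((b - θ) ⬝ᵥ (b - θ)) ≤
      4 * ((lsEstimate x z N - θ) ⬝ᵥ gram x N *ᵥ (lsEstimate x z N - θ)) +
        2 * c * ((∑ l, 2 / |θ l|) * √((b - θ) ⬝ᵥ (b - θ))) := by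
  set d := b - θ with hd
  have hG := posSemidef_gram x N
  have hbd : b = θ + d := by simp [hd]
  have h1 := eigMin_mul_le_dotProduct_mulVec hG.1 d
  have h2 := two_mul_dotProduct_mulVec_le hG (s := 1 / 2) (by norm_num) d
    (lsEstimate x z N - θ)
  have hpen : ∑ l, 1 / |modEstimate x z N l| * |θ l| ≤
      ∑ l, 1 / |modEstimate x z N l| * |b l| + (∑ l, 2 / |θ l|) * √(d ⬝ᵥ d) := by
    rw [Finset.sum_mul, ← Finset.sum_add_distrib]
    refine Finset.sum_le_sum fun l _ => ?_
    rcases eq_or_ne (θ l) 0 with h | h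
    -- Since 2 / 0 = 0, the sum of 2 / |θ l| runs in effect over the support of `θ`.
    · simp only [h, abs_zero, mul_zero, div_zero, zero_mul, add_zero]
      positivity
    · have h3 := abs_apply_le_sqrt_dotProduct_self d l
      have h4 : |θ l| ≤ |b l| + |d l| := by
        have := abs_sub (b l) (d l)
        rwa [hd, Pi.sub_apply, sub_sub_cancel, ← Pi.sub_apply b θ, ← hd] at this
      have hθ : 0 < |θ l| := abs_pos.2 h
      have h5 : 1 / |modEstimate x z N l| ≤ 2 / |θ l| := by
        rw [div_le_div_iff₀ (by linarith [hmod l h]) hθ]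
        linarith [hmod l h]
      have h6 : 0 ≤ 1 / |modEstimate x z N l| := by positivity
      calc _ ≤ 1 / |modEstimate x z N l| * (|b l| + |d l|) := by gcongr
        _ = 1 / |modEstimate x z N l| * |b l| + 1 / |modEstimate x z N l| * |d l| := by ring
        _ ≤ _ := by gcongr
  rw [criterion, criterion] at hb
  conv_lhs at hb => rw [hbd, sum_sq_add hpos, ← hbd]
  have h7 := mul_le_mul_of_nonneg_left hpen hc
  rw [show (1 / 2 : ℝ)⁻¹ = 2 by norm_num] at h2
  rw [lamMin]
  linarith

/-- A nonzero coordinate of the penalized estimate bounds the penalty weight. -/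
theorem mul_inv_abs_modEstimate_le {N : ℕ} (hpos : 0 < lamMin x N) {c : ℝ} {b : Fin r → ℝ}
    (hb : ∀ b', criterion x z c N b ≤ criterion x z c N b') {j : Fin r} (hj : b j ≠ 0)
    (hj1 : |b j| ≤ 1) (he : (lsEstimate x z N - b) ⬝ᵥ (lsEstimate x z N - b) ≤ 1) :
    c * (1 / |modEstimate x z N j|) ≤ 3 * lamMax x N := by
  have hG := posSemidef_gram x N
  set e := lsEstimate x z N - b with hedef
  set d : Fin r → ℝ := Pi.single j (b j) with hd
  have hlam : 0 ≤ lamMax x N := eigMax_nonneg hG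
  have hdd : d ⬝ᵥ d = |b j| ^ 2 := by simp [hd, sq]
  have h0 : 0 < |b j| := abs_pos.2 hj
  have h1 := hb (b + -d)
  rw [criterion, criterion, sum_sq_add hpos] at h1
  have hpen : ∑ l, 1 / |modEstimate x z N l| * |b l| =
      ∑ l, 1 / |modEstimate x z N l| * |(b + -d) l| + 1 / |modEstimate x z N j| * |b j| := by
    have h2 : ∀ l, 1 / |modEstimate x z N l| * |b l| =
        1 / |modEstimate x z N l| * |(b + -d) l| +
          if l = j then 1 / |modEstimate x z N j| * |b j| else 0 := fun l => by
      rcases eq_or_ne l j with rfl | h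
      · simp [hd]
      · simp [hd, h]
    rw [Finset.sum_congr rfl fun l _ => h2 l, Finset.sum_add_distrib]
    simp
  rw [hpen] at h1
  -- Weighting Young's inequality by |b j|⁻¹ makes both halves at most λ_max |b j|; with dᵀGd this
  -- gives the factor 3, and |b j| then cancels.
  have h3 := two_mul_dotProduct_mulVec_le hG (s := |b j|⁻¹) (by positivity) d e
  rw [inv_inv] at h3
  have h4 := dotProduct_mulVec_le_eigMax hG.1 d
  have h5 := dotProduct_mulVec_le_eigMax hG.1 e
  rw [hdd] at h4
  rw [← lamMax] at h4 h5
  simp only [neg_dotProduct, mulVec_neg, dotProduct_neg, neg_neg] at h1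
  have h6 : |b j|⁻¹ * (d ⬝ᵥ gram x N *ᵥ d) ≤ lamMax x N * |b j| := by
    calc _ ≤ |b j|⁻¹ * (lamMax x N * |b j| ^ 2) := by gcongr
      _ = _ := by field_simp
  have h7 : e ⬝ᵥ gram x N *ᵥ e ≤ lamMax x N := by nlinarith
  have h8 : |b j| * (e ⬝ᵥ gram x N *ᵥ e) ≤ |b j| * lamMax x N := by gcongr
  have h9 : lamMax x N * |b j| ^ 2 ≤ lamMax x N * |b j| := by
    gcongr
    nlinarith
  refine le_of_mul_le_mul_right ?_ h0
  linarith

theorem tendsto_rate_of_tendsto {x : ℕ → Fin r → ℝ}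
    (hpos : ∀ᶠ N in atTop, 0 < lamMin x N ∧ 1 < lamMax x N)
    (hexc : Tendsto (fun N => lamMax x N / lamMin x N * rate x N) atTop (𝓝 0)) :
    Tendsto (rate x) atTop (𝓝 0) := by
  refine tendsto_of_tendsto_of_tendsto_of_le_of_le' tendsto_const_nhds hexc
    (Eventually.of_forall fun N => Real.sqrt_nonneg _) ?_
  filter_upwards [hpos] with N hN
  have h1 : 1 ≤ lamMax x N / lamMin x N := by
    rw [le_div_iff₀ hN.1, one_mul]
    exact eigMin_le_eigMax (posSemidef_gram x N).1
  exact le_mul_of_one_le_left (Real.sqrt_nonneg _) h1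

theorem rate_sq {N : ℕ} (h : 0 < lamMin x N ∧ 1 < lamMax x N) :
    rate x N ^ 2 = Real.log (lamMax x N) / lamMin x N :=
  Real.sq_sqrt (div_nonneg (Real.log_nonneg h.2.le) h.1.le)

/-- λ_max is nondecreasing and eventually exceeds 1, so log λ_max stays away from 0; its ratio to
λ_min can vanish only if λ_min diverges. -/
theorem tendsto_lamMin_atTop (hpos : ∀ᶠ N in atTop, 0 < lamMin x N ∧ 1 < lamMax x N)
    (hrate : Tendsto (rate x) atTop (𝓝 0)) : Tendsto (lamMin x) atTop atTop := by
  obtain ⟨N₀, hN₀⟩ := eventually_atTop.1 hpos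
  have hl0 : 0 < Real.log (lamMax x N₀) := Real.log_pos (hN₀ N₀ le_rfl).2
  have hsq : Tendsto (fun N => rate x N ^ 2) atTop (𝓝 0) := by simpa using hrate.pow 2
  refine tendsto_atTop.2 fun B => ?_
  have hB : 0 < Real.log (lamMax x N₀) / (|B| + 1) := by positivity
  filter_upwards [hsq.eventually_lt_const hB, eventually_ge_atTop N₀] with N h1 h2
  have hN := hN₀ N h2
  have hmono : Real.log (lamMax x N₀) ≤ Real.log (lamMax x N) :=
    Real.log_le_log (by linarith [(hN₀ N₀ le_rfl).2]) (lamMax_mono x h2)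
  rw [rate_sq hN, div_lt_div_iff₀ hN.1 (by positivity)] at h1
  by_contra h
  push Not at h
  have h3 : lamMin x N ≤ |B| + 1 := by linarith [le_abs_self B]
  nlinarith [abs_nonneg B, hN.1]

/-- Sparsity and consistency of the penalized estimate along one sample path. -/
theorem eventually_eq_zero_and_tendsto {θ : Fin r → ℝ} {n : ℕ → ℝ}
    (hz : ∀ k, z (k + 1) = θ ⬝ᵥ x k + n (k + 1))
    (hpos : ∀ᶠ N in atTop, 0 < lamMin x N ∧ 1 < lamMax x N)
    (hexc : Tendsto (fun N => lamMax x N / lamMin x N * rate x N) atTop (𝓝 0))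
    {C : ℝ} (hC : ∀ N, (∑ k ∈ Finset.Icc 1 N, n (k + 1) • x k) ⬝ᵥ (1 + gram x N)⁻¹ *ᵥ
      (∑ k ∈ Finset.Icc 1 N, n (k + 1) • x k) ≤ C * (1 + Real.log (1 + gram x N).det))
    {c : ℕ → ℝ} (hc : ∀ᶠ N in atTop, 0 < c N)
    (hc1 : Tendsto (fun N => c N / lamMin x N) atTop (𝓝 0))
    (hc2 : Tendsto (fun N => lamMax x N * rate x N / c N) atTop (𝓝 0))
    {b : ℕ → Fin r → ℝ}
    (hb : ∀ᶠ N in atTop, IsMinOn (criterion x z (c N) N) Set.univ (b N)) :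
    (∀ᶠ N in atTop, ∀ j, θ j = 0 → b N j = 0) ∧
      ∀ i, Tendsto (fun N => b N i) atTop (𝓝 (θ i)) := by
  have hrate := tendsto_rate_of_tendsto hpos hexc
  have hrate0 : ∀ N, 0 ≤ rate x N := fun N => Real.sqrt_nonneg _
  have hmin := tendsto_lamMin_atTop hpos hrate
  set e : ℕ → Fin r → ℝ := fun N => lsEstimate x z N - θ with he
  have hdotnn : ∀ a : Fin r → ℝ, 0 ≤ a ⬝ᵥ a := fun a => by
    simpa using dotProduct_star_self_nonneg a
  -- the least squares error in the metric of the Gram matrix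
  obtain ⟨A, hA0, hA⟩ : ∃ A : ℝ, 0 ≤ A ∧ ∀ᶠ N in atTop,
      e N ⬝ᵥ gram x N *ᵥ e N ≤ A * Real.log (lamMax x N) := by
    have hlog2 : 0 < Real.log 2 := Real.log_pos one_lt_two
    -- Once λ_max ≥ 2, one has 1 ≤ log λ_max / log 2 and det(1 + G) ≤ (1 + λ_max)^r ≤ λ_max^{2r}.
    refine ⟨2 * |C| * ((Real.log 2)⁻¹ + 2 * r), by positivity, ?_⟩
    filter_upwards [hmin.eventually_ge_atTop 2] with N hN
    have hG := posSemidef_gram x N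
    have hmax : 2 ≤ lamMax x N := hN.trans (eigMin_le_eigMax hG.1)
    have hS : gram x N *ᵥ e N = ∑ k ∈ Finset.Icc 1 N, n (k + 1) • x k := by
      simp only [he]
      rw [mulVec_sub, gram_mulVec_lsEstimate (by linarith), gram_mulVec, ← Finset.sum_sub_distrib]
      refine Finset.sum_congr rfl fun k _ => ?_
      rw [hz, add_smul, add_sub_cancel_left]
    have h1 := dotProduct_mulVec_le_two_mul hG (by rw [lamMin] at hN; linarith) (e N)
    rw [hS] at h1
    rw [hS]
    have hdet := one_le_det_one_add hG
    have hl0 : 0 ≤ Real.log (1 + gram x N).det := Real.log_nonneg hdet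
    have h2 : Real.log (1 + gram x N).det ≤ 2 * r * Real.log (lamMax x N) := by
      have h3 : (1 + gram x N).det ≤ (lamMax x N ^ 2) ^ r := by
        refine (det_one_add_le hG).trans ?_
        rw [← lamMax]
        gcongr
        nlinarith
      calc _ ≤ Real.log ((lamMax x N ^ 2) ^ r) := Real.log_le_log (by linarith) h3
        _ = _ := by rw [Real.log_pow, Real.log_pow]; push_cast; ring
    have h4 : 1 ≤ (Real.log 2)⁻¹ * Real.log (lamMax x N) := by
      rw [inv_mul_eq_div, le_div_iff₀ hlog2, one_mul]
      exact Real.log_le_log two_pos hmax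
    calc _ ≤ 2 * (C * (1 + Real.log (1 + gram x N).det)) := h1.trans (by linarith [hC N])
      _ ≤ 2 * (|C| * (1 + Real.log (1 + gram x N).det)) := by
        gcongr; exact le_abs_self C
      _ ≤ 2 * (|C| * ((Real.log 2)⁻¹ * Real.log (lamMax x N) + 2 * r * Real.log (lamMax x N))) := by
        gcongr
      _ = _ := by ring
  have hee : ∀ᶠ N in atTop, e N ⬝ᵥ e N ≤ A * rate x N ^ 2 := by
    filter_upwards [hA, hpos] with N h1 h2
    rw [rate_sq h2, ← mul_div_assoc, le_div_iff₀ h2.1, mul_comm]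
    exact (eigMin_mul_le_dotProduct_mulVec (posSemidef_gram x N).1 _).trans h1
  have hej : ∀ᶠ N in atTop, ∀ j, |e N j| ≤ √A * rate x N := by
    filter_upwards [hee] with N hN j
    refine (abs_apply_le_sqrt_dotProduct_self _ j).trans ((Real.sqrt_le_sqrt hN).trans_eq ?_)
    rw [Real.sqrt_mul hA0, Real.sqrt_sq (hrate0 N)]
  -- the weights at the nonzero coordinates
  have hmod : ∀ᶠ N in atTop, ∀ l, θ l ≠ 0 → |θ l| / 2 ≤ |modEstimate x z N l| := by
    rw [eventually_all]
    intro l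
    by_cases hl : θ l = 0
    · simp [hl]
    have hpos' : 0 < |θ l| / 2 := by have := abs_pos.2 hl; positivity
    have h0 : Tendsto (fun N => √A * rate x N) atTop (𝓝 0) := by simpa using hrate.const_mul √A
    filter_upwards [hej, h0.eventually_le_const hpos'] with N h1 h2 _
    have h3 := h1 l
    have h4 : |θ l| ≤ |lsEstimate x z N l| + |e N l| := by
      have := abs_sub (lsEstimate x z N l) (e N l)
      simpa [he] using this
    rw [abs_modEstimate]
    linarith [hrate0 N]
  -- consistency
  set D : ℕ → ℝ := fun N => (b N - θ) ⬝ᵥ (b N - θ) with hD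
  set B := ∑ l, 2 / |θ l| with hB
  have hDle : ∀ᶠ N in atTop, D N ≤ 8 * (A * rate x N ^ 2) + (2 * B * (c N / lamMin x N)) ^ 2 := by
    filter_upwards [hA, hpos, hmod, hc, hb] with N h1 h2 h3 h4 h5
    have h6 := lamMin_mul_dotProduct_sub_le h2.1 h4.le (h5 (Set.mem_univ θ)) h3
    change lamMin x N * D N ≤ 4 * (e N ⬝ᵥ gram x N *ᵥ e N) + 2 * c N * (B * √(D N)) at h6
    have h7 : D N ≤ 4 * (A * rate x N ^ 2) + 2 * B * (c N / lamMin x N) * √(D N) := by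
      rw [rate_sq h2]
      have h8 : D N ≤ (4 * (A * Real.log (lamMax x N)) + 2 * c N * (B * √(D N))) / lamMin x N := by
        rw [le_div_iff₀ h2.1, mul_comm]
        linarith
      refine h8.trans_eq ?_
      ring
    have h8 : √(D N) ^ 2 = D N := Real.sq_sqrt (hdotnn _)
    -- The inequality for `D N` has √(D N) on its right; AM–GM moves half of `D N` to the left.
    nlinarith [sq_nonneg (2 * B * (c N / lamMin x N) - √(D N))]
  have hD0 : Tendsto D atTop (𝓝 0) := by
    refine tendsto_of_tendsto_of_tendsto_of_le_of_le' tendsto_const_nhds ?_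
      (Eventually.of_forall fun N => hdotnn _) hDle
    have h1 := ((hrate.pow 2).const_mul A).const_mul 8
    have h2 := (hc1.const_mul (2 * B)).pow 2
    simpa using h1.add h2
  have hbtend : ∀ i, Tendsto (fun N => b N i) atTop (𝓝 (θ i)) := fun i => by
    rw [tendsto_iff_dist_tendsto_zero]
    refine squeeze_zero (fun N => dist_nonneg) (fun N => ?_) (by simpa using hD0.sqrt)
    exact abs_apply_le_sqrt_dotProduct_self (b N - θ) i
  refine ⟨?_, hbtend⟩
  -- sparsity
  have hls : Tendsto (fun N => (lsEstimate x z N - b N) ⬝ᵥ (lsEstimate x z N - b N)) atTop (𝓝 0) := by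
    have h1 : Tendsto (fun N => 2 * (A * rate x N ^ 2) + 2 * D N) atTop (𝓝 0) := by
      simpa using (((hrate.pow 2).const_mul A).const_mul 2).add (hD0.const_mul 2)
    refine tendsto_of_tendsto_of_tendsto_of_le_of_le' tendsto_const_nhds h1
      (Eventually.of_forall fun N => hdotnn _) ?_
    filter_upwards [hee] with N hN
    have h2 : lsEstimate x z N - b N = e N - (b N - θ) := by simp [he]
    have h3 := hdotnn (e N + (b N - θ))
    rw [h2]
    simp only [add_dotProduct, dotProduct_add, sub_dotProduct (e N), dotProduct_sub _ (e N)] at h3 ⊢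
    simp only [hD]
    linarith
  have hsmall : Tendsto (fun N => 3 * (√A + 1) * (lamMax x N * rate x N / c N)) atTop (𝓝 0) := by
    simpa using hc2.const_mul (3 * (√A + 1))
  rw [eventually_all]
  intro j
  by_cases hj : θ j = 0
  swap
  · simp [hj]
  have hbj : ∀ᶠ N in atTop, |b N j| ≤ 1 := by
    have := (hbtend j).abs
    rw [hj, abs_zero] at this
    exact this.eventually_le_const one_pos
  filter_upwards [hbj, hls.eventually_le_const one_pos, hsmall.eventually_lt_const one_pos, hb, hc,
    hej, hpos] with N h1 h2 h3 h4 h5 h6 h7 _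
  by_contra hne
  have h8 := mul_inv_abs_modEstimate_le h7.1 (fun b' => h4 (Set.mem_univ b')) hne h1 h2
  -- Strict positivity keeps θ̂(j) away from 0, so the weight is a genuine reciprocal rather than 1
  -- / 0 = 0.
  have hrpos : 0 < rate x N := Real.sqrt_pos.2 (div_pos (Real.log_pos h7.2) h7.1)
  have h9 : |modEstimate x z N j| ≤ (√A + 1) * rate x N := by
    rw [abs_modEstimate]
    have := h6 j
    simp only [he, Pi.sub_apply, hj, sub_zero] at this
    linarith
  have h10 : 0 < |modEstimate x z N j| := by
    rw [abs_modEstimate]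
    linarith [abs_nonneg (lsEstimate x z N j)]
  rw [mul_one_div, div_le_iff₀ h10] at h8
  have h11 : 3 * lamMax x N * |modEstimate x z N j| ≤
      3 * lamMax x N * ((√A + 1) * rate x N) := by
    have := h7.2
    gcongr
  rw [← mul_div_assoc, div_lt_one h5] at h3
  linarith

end Deterministic

end SparseId
end

noncomputable section
namespace SparseId
open scoped ENNReal NNReal
open Matrix

/-! ### The information filtration and the main theorem -/

section Information

variable {Ω U V : Type*} [MeasurableSpace U] [MeasurableSpace V] {y : ℕ → Ω → ℝ} {u : ℕ → Ω → U}
  {w : ℕ → Ω → ℝ} {w' : ℕ → Ω → V}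

theorem info_mono : Monotone (info y u w w') := fun _ _ h =>
  sup_le_sup (sup_le_sup (sup_le_sup
    (biSup_mono fun _ hi => le_trans hi h) (biSup_mono fun _ hi => lt_of_lt_of_le hi h))
    (biSup_mono fun _ hi => le_trans hi h)) (biSup_mono fun _ hi => le_trans hi h)

theorem info_le [MeasurableSpace Ω] (hy : ∀ k, Measurable (y k)) (hu : ∀ k, Measurable (u k))
    (hw : ∀ k, Measurable (w k)) (hw' : ∀ k, Measurable (w' k)) (k : ℕ) :
    info y u w w' k ≤ ‹MeasurableSpace Ω› :=
  sup_le (sup_le (sup_le (iSup₂_le fun i _ => (hy i).comap_le) (iSup₂_le fun i _ => (hu i).comap_le))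
    (iSup₂_le fun i _ => (hw i).comap_le)) (iSup₂_le fun i _ => (hw' i).comap_le)

theorem measurable_noise_info (k : ℕ) : Measurable[info y u w w' k] (w k) :=
  Measurable.mono (comap_measurable (w k))
    ((le_iSup₂_of_le (f := fun i (_ : i ∈ Set.Iic k) => MeasurableSpace.comap (w i) inferInstance)
      k (Set.mem_Iic.2 le_rfl) le_rfl).trans (le_sup_right.trans le_sup_left)) le_rfl

/-- The information available from time `1` on, as a filtration. -/
def infoFiltration [MeasurableSpace Ω] (hy : ∀ k, Measurable (y k)) (hu : ∀ k, Measurable (u k))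
    (hw : ∀ k, Measurable (w k)) (hw' : ∀ k, Measurable (w' k)) :
    Filtration ℕ ‹MeasurableSpace Ω› where
  seq n := info y u w w' (n + 1)
  mono' := fun _ _ h => info_mono (Nat.succ_le_succ h)
  le' n := info_le hy hu hw hw' (n + 1)

end Information

theorem sum_Icc_one_eq_sum_range {E : Type*} [AddCommMonoid E] (f : ℕ → E) (N : ℕ) :
    ∑ k ∈ Finset.Icc 1 N, f k = ∑ k ∈ Finset.range N, f (k + 1) := by
  rw [Finset.range_eq_Ico, Finset.sum_Ico_add' f 0 N 1]
  rfl

end SparseId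

end

theorem theorem1 {Ω : Type*} [MeasurableSpace Ω] (P : Measure Ω) [IsProbabilityMeasure P]
    {U V : Type*} [MeasurableSpace U] [MeasurableSpace V] {r : ℕ}
    -- parameter, regressors, outputs, inputs, noise, exogenous signals
    (θ : Fin r → ℝ) (φ : ℕ → Ω → Fin r → ℝ) (y : ℕ → Ω → ℝ) (u : ℕ → Ω → U)
    (w : ℕ → Ω → ℝ) (w' : ℕ → Ω → V)
    (hy : ∀ k, Measurable (y k)) (hu : ∀ k, Measurable (u k))
    (hw : ∀ k, Measurable (w k)) (hw' : ∀ k, Measurable (w' k))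
    -- the system
    (hsys : ∀ k ω, y (k + 1) ω = θ ⬝ᵥ φ k ω + w (k + 1) ω)
    -- A1: martingale difference noise with bounded conditional moments of order `γ > 2`
    (hint : ∀ k ≥ 1, Integrable (w (k + 1)) P)
    (hmart : ∀ k ≥ 1, P[w (k + 1) | SparseId.info y u w w' k] =ᵐ[P] 0)
    (γ : ℝ) (hγ : 2 < γ)
    (hmom : ∀ᵐ ω ∂P, (⨆ k ≥ 1, condLExp (SparseId.info y u w w' k) P
      (fun ω' => ENNReal.ofReal (|w (k + 1) ω'| ^ γ)) ω) < ⊤)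
    -- A2: adapted regressors
    (hφ : ∀ k ≥ 1, Measurable[SparseId.info y u w w' k] (φ k))
    -- the quantities in A3 and A4 are eventually well defined and positive
    (hpos : ∀ᵐ ω ∂P, ∀ᶠ N in atTop,
      0 < SparseId.lamMin (φ · ω) N ∧ 1 < SparseId.lamMax (φ · ω) N)
    -- A3: excitation
    (hexc : ∀ᵐ ω ∂P, Tendsto (fun N => SparseId.lamMax (φ · ω) N / SparseId.lamMin (φ · ω) N *
      SparseId.rate (φ · ω) N) atTop (𝓝 0))
    -- A4: choice of the regularization coefficients (which may depend on the data)
    (lam : ℕ → Ω → ℝ) (hlam : ∀ᵐ ω ∂P, ∀ᶠ N in atTop, 0 < lam N ω)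
    (hlam₁ : ∀ᵐ ω ∂P, Tendsto (fun N => lam N ω / SparseId.lamMin (φ · ω) N) atTop (𝓝 0))
    (hlam₂ : ∀ᵐ ω ∂P, Tendsto (fun N => SparseId.lamMax (φ · ω) N *
      SparseId.rate (φ · ω) N / lam N ω) atTop (𝓝 0))
    -- the estimates: minimizers of the weighted criterion
    (β : ℕ → Ω → Fin r → ℝ)
    (hβ : ∀ᵐ ω ∂P, ∀ᶠ N in atTop,
      IsMinOn (SparseId.criterion (φ · ω) (y · ω) (lam N ω) N) Set.univ (β (N + 1) ω)) :
    ∀ᵐ ω ∂P,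
      (∃ N₀ : ℕ, ∀ N ≥ N₀, ∀ j, θ j = 0 → β (N + 1) ω j = 0) ∧
      (∀ i, θ i ≠ 0 → Tendsto (fun N => β (N + 1) ω i) atTop (𝓝 (θ i))) := by
  set ℱ := SparseId.infoFiltration hy hu hw hw' with hℱ
  have hmom' : ∀ᵐ ω ∂P, ⨆ n, condLExp (ℱ n) P
      (fun ω => ENNReal.ofReal (|w (n + 2) ω| ^ γ)) ω < ⊤ := by
    filter_upwards [hmom] with ω hω
    refine lt_of_le_of_lt (iSup_le fun n => ?_) hω
    exact le_iSup₂_of_le (f := fun k (_ : k ≥ 1) => condLExp (SparseId.info y u w w' k) P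
      (fun ω' => ENNReal.ofReal (|w (k + 1) ω'| ^ γ)) ω) (n + 1) (Nat.le_add_left 1 n) le_rfl
  -- Time is shifted by one: step n of the filtration is the information at n + 1, so the pair
  -- (φ_{n+1}, w_{n+2}) becomes (x_n, v_n) and sums over 1, …, N become sums over `range N`.
  have hLW := SparseId.ae_exists_quadForm_score_le_of_iSup_lt_top (P := P) (ℱ := ℱ) hγ
    (x := fun n => φ (n + 1)) (v := fun n => w (n + 2))
    (fun n => hφ (n + 1) (Nat.le_add_left 1 n)) (fun n => SparseId.measurable_noise_info (n + 2))
    (fun n => hint (n + 1) (Nat.le_add_left 1 n)) (fun n => hmart (n + 1) (Nat.le_add_left 1 n))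
    hmom'
  filter_upwards [hLW, hpos, hexc, hlam, hlam₁, hlam₂, hβ] with ω ⟨C, hC⟩ h1 h2 h3 h4 h5 h6
  obtain ⟨hzero, htend⟩ := SparseId.eventually_eq_zero_and_tendsto (x := (φ · ω)) (z := (y · ω))
    (n := (w · ω)) (b := fun N => β (N + 1) ω) (fun k => hsys k ω) h1 h2 (C := C) (fun N => by
      have h := hC N
      simp only [SparseId.score, SparseId.regGram] at h
      simpa only [SparseId.gram, SparseId.sum_Icc_one_eq_sum_range] using h) h3 h4 h5 h6
  exact ⟨eventually_atTop.1 hzero, fun i _ => htend i⟩
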